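/- Let $S^1=\mathbb R/\mathbb Z$. Fix a regularity class, either $C^k$ with $k\in\{1,2,\dots,\infty\}$ or Sobolev $W^{k,p}$ with $k\in\{1,2,\dots\}$, $1\le p<\infty$. Let $L\mathbb C=C^k(S^1)$, resp. $W^{k,p}(S^1)$, and $L^-\mathbb C=C^{k-1}(S^1)$, resp. $W^{k-1,p}(S^1)$ (complex valued functions, with their usual Banach or Fréchet topologies; $\infty-1=\infty$, $W^{0,p}=L^p$). Let $\mathfrak F$ be the space of holomorphic functions $F\colon\mathbb C\times L\mathbb C\to\mathbb C$ (that is, $F$ is continuous and holomorphic along each complex line) such that, for all $\zeta\in\mathbb C$ and $x,y\in L\mathbb C$, 1. $F(\zeta/\lambda,\lambda^2y)=O(\lambda^2)$ as $\mathbb C\ni\lambda\to0$; 2. $F(\zeta,x+y)=F(\zeta,x)+F(\zeta,y)$ if $\operatorname{supp}x\cap\operatorname{supp}y=\emptyset$; 3. $F(\zeta,y+c)=F(\zeta,y)$ for every constant $c\in\mathbb C$; $\mathfrak F$ carries the compact-open topology. Let $\mathfrak F^0\subset\mathfrak F$ be the subspace of those $F$ with $F(\zeta,cy)=cF(\zeta,y)$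 for all $c,\zeta\in\mathbb C$, $y\in L\mathbb C$. Let $(L^-\mathbb C)^*$ be the space of continuous linear forms on $L^-\mathbb C$ with the compact-open topology, and let $\mathbb C\subset(L^-\mathbb C)^*$ stand for the (one-dimensional) subspace of the forms $x\mapsto c\int_{S^1}x$, $c\in\mathbb C$. **Theorem.** $\mathfrak F^0$ consists exactly of those $F\in\mathfrak F$ that are fixed by the action $(gF)(\zeta,y)=F(g\zeta,y/J_g(\zeta))\,J_g(\zeta)$, $J_g(\zeta)=dg\zeta/d\zeta$, of the group $PSL(2,\mathbb C)$ of Möbius transformations $g$ (the equality $gF=F$ being required wherever $g\zeta\neq\infty$). The map that sends the class of $\Phi\in(L^-\mathbb C)^*$ to the function $F(\zeta,y)=\langle\Phi,\dot y\rangle$ is well defined and is an isomorphism of topological vector spaces $$(L^-\mathbb C)^*/\mathbb C\;\approx\;\mathfrak F^0 .$$ If $L^-\mathbb C$ is interpreted as the space of one-forms $x(t)\,dt$ on $S^1$ of the corresponding regularity, then this isomorphism is equivariant under $\operatorname{Diff}S^1$, the group of $C^k$ diffeomorphisms of $S^1$: for each $\varphi\in\operatorname{Diff}S^1$ the pullbacks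 $\varphi^*y=y\circ\varphi$ and $\varphi^*(x\,dt)=(x\circ\varphi)\,\varphi'\,dt$ are continuous linear operators on $L\mathbb C$ and on $L^-\mathbb C$, and if the class of $\Phi$ corresponds to $F$, then the class of $\Phi\circ\varphi^*$ corresponds to the function $(\zeta,y)\mapsto F(\zeta,\varphi^*y)$. -/

import Mathlib

open MeasureTheory Filter Topology Asymptotics
open scoped ENNReal CompactConvergenceCLM

noncomputable section

namespace LoopSpace

/-! ### Functions on the circle `S¹ = ℝ / ℤ` -/

/-- The circle `ℝ / ℤ`, with its Lebesgue measure `volume` of total mass one. -/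
abbrev S1 : Type := UnitAddCircle

/-- `f : S¹ → ℂ` is of class `C^l`, `l = 0, 1, …, ∞`: its `1`-periodic lift to `ℝ` is. -/
def IsCk (l : ℕ∞) (f : S1 → ℂ) : Prop :=
  ContDiff ℝ (l : WithTop ℕ∞) (fun s : ℝ => f (s : S1))

/-- The derivative `ḟ = df/dt` of a function on the circle. -/
def circleDeriv (f : S1 → ℂ) (t : S1) : ℂ :=
  deriv (fun s : ℝ => f (t + (s : S1))) 0

lemma circleDeriv_coe (f : S1 → ℂ) :
    (fun s : ℝ => circleDeriv f (s : S1)) = deriv (fun s : ℝ => f (s : S1)) := by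
  funext s
  have h := deriv_comp_const_add (fun u : ℝ => f (u : S1)) s 0
  simpa [circleDeriv, AddCircle.coe_add] using h

lemma circleDeriv_iterate_coe (f : S1 → ℂ) (j : ℕ) :
    (fun s : ℝ => (circleDeriv^[j] f) (s : S1)) = iteratedDeriv j (fun s : ℝ => f (s : S1)) := by
  induction j with
  | zero => simp
  | succ j ih => rw [Function.iterate_succ_apply', circleDeriv_coe, ih, iteratedDeriv_succ]

lemma continuous_of_coe {f : S1 → ℂ} (h : Continuous (fun s : ℝ => f (s : S1))) :
    Continuous f :=
  continuous_coinduced_dom.mpr h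

lemma IsCk.continuous_iterate {l : ℕ∞} {f : S1 → ℂ} (hf : IsCk l f) {j : ℕ}
    (hj : (j : ℕ∞) ≤ l) : Continuous (circleDeriv^[j] f) := by
  apply continuous_of_coe
  rw [circleDeriv_iterate_coe]
  exact ContDiff.continuous_iteratedDeriv j hf (by exact_mod_cast hj)

lemma IsCk.circleDeriv {l : ℕ∞} {f : S1 → ℂ} (hf : IsCk (l + 1) f) :
    IsCk l (circleDeriv f) := by
  have hf' : ContDiff ℝ ((l : WithTop ℕ∞) + 1) (fun s : ℝ => f (s : S1)) := by
    have h := hf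
    unfold IsCk at h
    exact_mod_cast h
  unfold IsCk
  rw [circleDeriv_coe]
  exact (contDiff_succ_iff_deriv.mp hf').2.2

/-! ### The spaces `C^l(S¹)` -/

def ckSubmodule (l : ℕ∞) : Submodule ℂ (S1 → ℂ) where
  carrier := {f | IsCk l f}
  add_mem' {f g} hf hg := show ContDiff ℝ _ (fun s : ℝ => f (s : S1) + g (s : S1)) from
    ContDiff.add (show IsCk l f from hf) (show IsCk l g from hg)
  zero_mem' := show IsCk l 0 from
    (contDiff_const : ContDiff ℝ (l : WithTop ℕ∞) (fun _ : ℝ => (0 : ℂ)))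
  smul_mem' c f hf := show ContDiff ℝ _ (fun s : ℝ => c • f (s : S1)) from
    ContDiff.const_smul c (show IsCk l f from hf)

/-- `C^l(S¹)`, `l = 0, 1, …, ∞`. -/
def Ck (l : ℕ∞) : Type := ↥(ckSubmodule l)

instance (l : ℕ∞) : AddCommGroup (Ck l) := inferInstanceAs (AddCommGroup ↥(ckSubmodule l))
instance (l : ℕ∞) : Module ℂ (Ck l) := inferInstanceAs (Module ℂ ↥(ckSubmodule l))

/-- The underlying function of an element of `C^l(S¹)`. -/
def Ck.fn {l : ℕ∞} (f : Ck l) : S1 → ℂ := f.1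

/-- The `j`-th derivative, `j ≤ l`, of an element of `C^l(S¹)`, as a continuous function. -/
def Ck.iterDeriv {l : ℕ∞} (f : Ck l) (j : ℕ) (hj : (j : ℕ∞) ≤ l) : C(S1, ℂ) :=
  ⟨circleDeriv^[j] f.fn, IsCk.continuous_iterate (show IsCk l f.fn from f.2) hj⟩

/-- The Banach (`l < ∞`) or Fréchet (`l = ∞`) topology of `C^l(S¹)`: uniform convergence of each
derivative of order at most `l`. -/
instance (l : ℕ∞) : TopologicalSpace (Ck l) :=
  TopologicalSpace.induced
    (fun f (j : {j : ℕ // (j : ℕ∞) ≤ l}) => f.iterDeriv j.1 j.2) inferInstance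

/-- `y ↦ ẏ`, `C^{l+1}(S¹) → C^l(S¹)`. -/
def Ck.dot {l : ℕ∞} (y : Ck (l + 1)) : Ck l :=
  ⟨circleDeriv y.fn, IsCk.circleDeriv (show IsCk (l + 1) y.fn from y.2)⟩

/-! ### The Sobolev spaces `W^{l,p}(S¹)` -/

/-- `v` is the weak derivative of `u`, both in `L^p(S¹)`. -/
def HasWeakDeriv {p : ℝ≥0∞} (u v : Lp ℂ p (volume : Measure S1)) : Prop :=
  ∀ φ : S1 → ℂ, IsCk ⊤ φ → ∫ t, u t * circleDeriv φ t = - ∫ t, v t * φ t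

lemma integrable_mul_of_continuous {p : ℝ≥0∞} [Fact (1 ≤ p)]
    (u : Lp ℂ p (volume : Measure S1)) {φ : S1 → ℂ} (hφ : Continuous φ) :
    Integrable (fun t => u t * φ t) (volume : Measure S1) := by
  have hu : Integrable (fun t => u t) (volume : Measure S1) := (Lp.memLp u).integrable Fact.out
  obtain ⟨C, hC⟩ := isCompact_univ.exists_bound_of_continuousOn hφ.continuousOn
  exact hu.mul_bdd (c := C) hφ.aestronglyMeasurable (ae_of_all _ fun t => hC t trivial)

lemma IsCk.continuous {l : ℕ∞} {f : S1 → ℂ} (hf : IsCk l f) : Continuous f :=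
  continuous_of_coe (ContDiff.continuous hf)

lemma IsCk.continuous_circleDeriv {f : S1 → ℂ} (hf : IsCk ⊤ f) :
    Continuous (LoopSpace.circleDeriv f) :=
  IsCk.continuous_iterate (j := 1) hf le_top

lemma HasWeakDeriv.add {p : ℝ≥0∞} [Fact (1 ≤ p)] {u v u' v' : Lp ℂ p (volume : Measure S1)}
    (h : HasWeakDeriv u v) (h' : HasWeakDeriv u' v') : HasWeakDeriv (u + u') (v + v') := by
  intro φ hφ
  have e1 : ∫ t, (u + u') t * circleDeriv φ t
      = ∫ t, (u t * circleDeriv φ t + u' t * circleDeriv φ t) := by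
    apply integral_congr_ae
    filter_upwards [Lp.coeFn_add u u'] with t ht
    rw [ht, Pi.add_apply, add_mul]
  have e2 : ∫ t, (v + v') t * φ t = ∫ t, (v t * φ t + v' t * φ t) := by
    apply integral_congr_ae
    filter_upwards [Lp.coeFn_add v v'] with t ht
    rw [ht, Pi.add_apply, add_mul]
  rw [e1, e2, integral_add (integrable_mul_of_continuous u hφ.continuous_circleDeriv)
    (integrable_mul_of_continuous u' hφ.continuous_circleDeriv),
    integral_add (integrable_mul_of_continuous v hφ.continuous)
    (integrable_mul_of_continuous v' hφ.continuous), h φ hφ, h' φ hφ]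
  ring

lemma HasWeakDeriv.smul {p : ℝ≥0∞} {u v : Lp ℂ p (volume : Measure S1)} (c : ℂ)
    (h : HasWeakDeriv u v) : HasWeakDeriv (c • u) (c • v) := by
  intro φ hφ
  have e1 : ∫ t, (c • u) t * circleDeriv φ t = ∫ t, c * (u t * circleDeriv φ t) := by
    apply integral_congr_ae
    filter_upwards [Lp.coeFn_smul c u] with t ht
    rw [ht, Pi.smul_apply, smul_eq_mul, mul_assoc]
  have e2 : ∫ t, (c • v) t * φ t = ∫ t, c * (v t * φ t) := by
    apply integral_congr_ae
    filter_upwards [Lp.coeFn_smul c v] with t ht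
    rw [ht, Pi.smul_apply, smul_eq_mul, mul_assoc]
  rw [e1, e2, integral_const_mul, integral_const_mul, h φ hφ]
  ring

/-- `w 0, …, w l` are `u` and its weak derivatives of order at most `l`, all in `L^p(S¹)`. -/
def IsWeakJet {p : ℝ≥0∞} (l : ℕ) (u : Lp ℂ p (volume : Measure S1))
    (w : ℕ → Lp ℂ p (volume : Measure S1)) : Prop :=
  w 0 = u ∧ ∀ j < l, HasWeakDeriv (w j) (w (j + 1))

def sobolevSubmodule (l : ℕ) (p : ℝ≥0∞) [Fact (1 ≤ p)] :
    Submodule ℂ (Lp ℂ p (volume : Measure S1)) where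
  carrier := {u | ∃ w, IsWeakJet l u w}
  add_mem' := by
    rintro u u' ⟨w, hw0, hw⟩ ⟨w', hw0', hw'⟩
    exact ⟨w + w', by simp [hw0, hw0'], fun j hj => (hw j hj).add (hw' j hj)⟩
  zero_mem' := by
    refine ⟨0, rfl, fun j _ φ _ => ?_⟩
    have h0 : ∀ ψ : S1 → ℂ,
        ∫ t, (0 : Lp ℂ p (volume : Measure S1)) t * ψ t = 0 := by
      intro ψ
      apply integral_eq_zero_of_ae
      filter_upwards [Lp.coeFn_zero ℂ p (volume : Measure S1)] with t ht
      have h1 : (0 : Lp ℂ p (volume : Measure S1)) t = 0 := ht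
      rw [h1, zero_mul, Pi.zero_apply]
    exact (h0 _).trans (neg_eq_zero.mpr (h0 φ)).symm
  smul_mem' := by
    rintro c u ⟨w, hw0, hw⟩
    exact ⟨c • w, by simp [hw0], fun j hj => (hw j hj).smul c⟩

/-- `W^{l,p}(S¹)`: the `L^p` functions with weak derivatives of order at most `l` in `L^p`;
`W^{0,p}(S¹) = L^p(S¹)`. -/
def Sob (l : ℕ) (p : ℝ≥0∞) [Fact (1 ≤ p)] : Type := ↥(sobolevSubmodule l p)

section Sob

variable {l : ℕ} {p : ℝ≥0∞} [Fact (1 ≤ p)]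

instance : AddCommGroup (Sob l p) := inferInstanceAs (AddCommGroup ↥(sobolevSubmodule l p))
instance : Module ℂ (Sob l p) := inferInstanceAs (Module ℂ ↥(sobolevSubmodule l p))

/-- A function representing an element of `W^{l,p}(S¹)`, determined up to null sets. -/
def Sob.fn (u : Sob l p) : S1 → ℂ := (u.1 : S1 → ℂ)

/-- The weak derivatives of `u ∈ W^{l,p}(S¹)`; as weak derivatives are unique, only the values at
`j > l` depend on a choice. -/
def Sob.weakDeriv (u : Sob l p) : ℕ → Lp ℂ p (volume : Measure S1) :=
  Classical.choose u.2

lemma Sob.weakDeriv_spec (u : Sob l p) : IsWeakJet l u.1 u.weakDeriv :=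
  Classical.choose_spec u.2

/-- The Banach space topology of `W^{l,p}(S¹)`: `L^p` convergence of all weak derivatives of order
at most `l`. -/
instance : TopologicalSpace (Sob l p) :=
  TopologicalSpace.induced (fun u (j : Fin (l + 1)) => u.weakDeriv j) inferInstance

/-- `y ↦ ẏ`, `W^{l+1,p}(S¹) → W^{l,p}(S¹)`. -/
def Sob.dot (y : Sob (l + 1) p) : Sob l p :=
  ⟨y.weakDeriv 1, fun j => y.weakDeriv (j + 1), rfl,
    fun j hj => y.weakDeriv_spec.2 (j + 1) (by omega)⟩

end Sob

/-! ### The space `𝔉` and its subspaces -/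

/-- The support of a function on the circle given up to null sets: the complement of the largest
open set on which it vanishes almost everywhere. For a continuous function this is the closure of
the set where it does not vanish. -/
def circleSupp (f : S1 → ℂ) : Set S1 :=
  {t | ∀ U ∈ 𝓝 t, ¬ ∀ᵐ s ∂(volume : Measure S1), s ∈ U → f s = 0}

section FSpace

/- `V` is one of the spaces of functions on the circle defined above, and `ρ y` is the function
that represents `y ∈ V`. -/
variable {V : Type} [AddCommGroup V] [Module ℂ V] [TopologicalSpace V]

/-- A continuous function on `ℂ × V` is holomorphic if it is holomorphic along each complex
line. -/
def IsHolomorphic (F : C(ℂ × V, ℂ)) : Prop :=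
  ∀ a b : ℂ × V, Differentiable ℂ (fun z : ℂ => F (a + z • b))

/-- The space `𝔉` of holomorphic functions on `ℂ × V` with the three defining properties. As a
subspace of `C(ℂ × V, ℂ)` it carries the compact-open topology. -/
def FSpace (ρ : V → S1 → ℂ) : Submodule ℂ C(ℂ × V, ℂ) where
  carrier := {F | IsHolomorphic F ∧
    (∀ (ζ : ℂ) (y : V),
      (fun z : ℂ => F (ζ / z, z ^ 2 • y)) =O[𝓝[≠] (0 : ℂ)] (fun z : ℂ => z ^ 2)) ∧
    (∀ (ζ : ℂ) (x y : V), circleSupp (ρ x) ∩ circleSupp (ρ y) = ∅ →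
      F (ζ, x + y) = F (ζ, x) + F (ζ, y)) ∧
    (∀ (ζ : ℂ) (y e : V), (∃ c : ℂ, ∀ᵐ t ∂(volume : Measure S1), ρ e t = c) →
      F (ζ, y + e) = F (ζ, y))}
  add_mem' := by
    rintro F G ⟨hF, hF1, hF2, hF3⟩ ⟨hG, hG1, hG2, hG3⟩
    refine ⟨fun a b => (hF a b).add (hG a b), fun ζ y => (hF1 ζ y).add (hG1 ζ y), ?_, ?_⟩
    · intro ζ x y h
      simp only [ContinuousMap.add_apply, hF2 ζ x y h, hG2 ζ x y h]
      ring
    · intro ζ y e h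
      simp only [ContinuousMap.add_apply, hF3 ζ y e h, hG3 ζ y e h]
  zero_mem' := by
    refine ⟨fun a b => differentiable_const 0, fun ζ y => isBigO_zero _ _, ?_, ?_⟩
    · intro ζ x y _
      simp
    · intro ζ y e _
      simp
  smul_mem' := by
    rintro c F ⟨hF, hF1, hF2, hF3⟩
    refine ⟨fun a b => (hF a b).const_smul c, fun ζ y => (hF1 ζ y).const_smul_left c, ?_, ?_⟩
    · intro ζ x y h
      simp only [ContinuousMap.smul_apply, hF2 ζ x y h, smul_add]
    · intro ζ y e h
      simp only [ContinuousMap.smul_apply, hF3 ζ y e h]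

/-- `𝔉ⁿ ⊆ 𝔉`: the posthomogeneous functions of degree `n + 1`. -/
def FHom (ρ : V → S1 → ℂ) (n : ℕ) : Submodule ℂ C(ℂ × V, ℂ) where
  carrier := {F | F ∈ FSpace ρ ∧ ∀ (ζ c : ℂ) (y : V), F (ζ, c • y) = c ^ (n + 1) * F (ζ, y)}
  add_mem' := by
    rintro F G ⟨hF, hF'⟩ ⟨hG, hG'⟩
    refine ⟨add_mem hF hG, fun ζ c y => ?_⟩
    simp only [ContinuousMap.add_apply, hF', hG']
    ring
  zero_mem' := ⟨zero_mem _, fun ζ c y => by simp⟩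
  smul_mem' := by
    rintro a F ⟨hF, hF'⟩
    refine ⟨Submodule.smul_mem _ a hF, fun ζ c y => ?_⟩
    simp only [ContinuousMap.smul_apply, hF', smul_eq_mul]
    ring

/-- `F` is fixed by the action `(gF)(ζ, y) = F(gζ, y / J_g(ζ)) J_g(ζ)` of `G = PSL(2, ℂ)`. Here
`gζ = (aζ + b)/(cζ + d)` with `ad - bc = 1`, so that `J_g(ζ) = dgζ/dζ = (cζ + d)⁻²`. -/
def IsGFixed (F : C(ℂ × V, ℂ)) : Prop :=
  ∀ g : Matrix.SpecialLinearGroup (Fin 2) ℂ, ∀ (ζ : ℂ) (y : V), g 1 0 * ζ + g 1 1 ≠ 0 →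
    F ((g 0 0 * ζ + g 0 1) / (g 1 0 * ζ + g 1 1), (g 1 0 * ζ + g 1 1) ^ 2 • y)
      * ((g 1 0 * ζ + g 1 1) ^ 2)⁻¹ = F (ζ, y)

/-- The multiples `x ↦ c ∫ x` of the integral in the dual `V^*`, which carries the compact-open
topology. -/
def integralLine (ρ : V → S1 → ℂ) : Submodule ℂ (V →L_c[ℂ] ℂ) where
  carrier := {Φ | ∃ c : ℂ, ∀ x : V, Φ x = c * ∫ t, ρ x t}
  add_mem' := by
    rintro Φ Ψ ⟨c, hc⟩ ⟨d, hd⟩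
    refine ⟨c + d, fun x => ?_⟩
    rw [add_mul, ← hc, ← hd]
    rfl
  zero_mem' := ⟨0, fun x => by rw [zero_mul]; rfl⟩
  smul_mem' := by
    rintro a Φ ⟨c, hc⟩
    refine ⟨a * c, fun x => ?_⟩
    rw [mul_assoc, ← hc]
    rfl

end FSpace

/-! ### Diffeomorphisms of the circle -/

/-- A homeomorphism of the circle that lifts to a `C^k` map `ℝ → ℝ`, and whose inverse does:
a `C^k` diffeomorphism, orientation preserving or not. -/
structure CircleDiffeo (k : ℕ∞) where
  toHomeomorph : S1 ≃ₜ S1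
  exists_lift : ∃ ψ : ℝ → ℝ, ContDiff ℝ (k : WithTop ℕ∞) ψ ∧
    ∀ s : ℝ, toHomeomorph (s : S1) = (ψ s : S1)
  exists_lift_symm : ∃ ψ : ℝ → ℝ, ContDiff ℝ (k : WithTop ℕ∞) ψ ∧
    ∀ s : ℝ, toHomeomorph.symm (s : S1) = (ψ s : S1)

/-- The derivative `φ'(t)` of a diffeomorphism `φ`: the derivative of a lift to `ℝ`, which depends
neither on the lift nor on the point of `ℝ` over `t`. -/
def CircleDiffeo.deriv {k : ℕ∞} (φ : CircleDiffeo k) (t : S1) : ℝ :=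
  _root_.deriv (Classical.choose φ.exists_lift) (AddCircle.equivIco 1 0 t : ℝ)

/-- `A` is the pullback of functions, `φ^* y = y ∘ φ`. -/
def IsFunctionPullback {k : ℕ∞} (φ : CircleDiffeo k) {V : Type} (ρ : V → S1 → ℂ)
    (A : V → V) : Prop :=
  ∀ y : V, ∀ᵐ t ∂(volume : Measure S1), ρ (A y) t = ρ y (φ.toHomeomorph t)

/-- `B` is the pullback of one-forms, `φ^* (x(t) dt) = x(φ(t)) φ'(t) dt`. -/
def IsFormPullback {k : ℕ∞} (φ : CircleDiffeo k) {V : Type} (ρ : V → S1 → ℂ)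
    (B : V → V) : Prop :=
  ∀ x : V, ∀ᵐ t ∂(volume : Measure S1),
    ρ (B x) t = ρ x (φ.toHomeomorph t) * (φ.deriv t : ℂ)

end LoopSpace

end

/-!
By homogeneity and Liouville's theorem on complex lines, a function in `𝔉⁰` is linear in `y`. For
`F` linear in `y` the growth condition says that `z ↦ F(z, y)` is bounded at infinity, so that `F`
does not depend on `ζ`. Conversely, invariance under the Möbius maps `ζ ↦ a ζ + b` gives
homogeneity. Hence an element of `𝔉⁰` is a continuous linear form on the loops that vanishes on the
constants. Differentiation `y ↦ ẏ` has the constants as its kernel, and the primitive of `x - ∫ x`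
inverts it up to the constants and up to `∫ x`, continuously; composing with these two operators
gives the isomorphism and its inverse.

Both regularity classes consist of the elements with `l` derivatives of a normed space of functions,
`C(S¹)` with the classical or `L^p` with the weak derivative. All that is used of such a space is a
derivative, a primitive operator and the pullbacks `u ↦ c · (u ∘ φ)`.
-/

noncomputable section

namespace LoopSpace

/-! ### Liouville theorems and homogeneous holomorphic functions -/

section Liouville

open Bornology

variable {E : Type*} [NormedAddCommGroup E] [NormedSpace ℂ E] [CompleteSpace E]

lemma slope_eq_of_tendsto_cobounded {g : ℂ → E} (hg : Differentiable ℂ g) {a z : ℂ} {m : E}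
    (h : Tendsto (slope g a) (cobounded ℂ) (𝓝 m)) (hz : z ≠ a) : slope g a z = m := by
  have hd : Differentiable ℂ (dslope g a) :=
    differentiableOn_univ.mp ((Complex.differentiableOn_dslope univ_mem).mpr hg.differentiableOn)
  have ht : Tendsto (dslope g a) (cocompact ℂ) (𝓝 m) := by
    rw [← Metric.cobounded_eq_cocompact]
    refine h.congr' ?_
    filter_upwards [eventually_ne_cobounded a] with w hw
    exact (dslope_of_ne g hw).symm
  rw [← dslope_of_ne g hz, hd.apply_eq_of_tendsto_cocompact z ht]

lemma apply_eq_apply_of_isBigO_one {g : ℂ → E} (hg : Differentiable ℂ g)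
    (h : g =O[cobounded ℂ] (fun _ => (1 : ℂ))) (z w : ℂ) : g z = g w := by
  rcases eq_or_ne z w with rfl | hzw
  · rfl
  have hinv : Tendsto (fun u : ℂ => (u - w)⁻¹) (cobounded ℂ) (𝓝 0) :=
    tendsto_inv₀_cobounded.comp (tendsto_sub_const_cobounded w)
  have hslope : Tendsto (slope g w) (cobounded ℂ) (𝓝 0) := by
    have hb := (isBigO_refl (fun u : ℂ => (u - w)⁻¹) (cobounded ℂ)).smul
      (h.sub (isBigO_const_const (g w) one_ne_zero _))
    exact hb.trans_tendsto (by simpa using hinv)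
  have h0 := slope_eq_of_tendsto_cobounded hg hslope hzw
  rwa [slope_def_module, smul_eq_zero_iff_right (inv_ne_zero (sub_ne_zero.mpr hzw)),
    sub_eq_zero] at h0

variable {V : Type*} [AddCommGroup V] [Module ℂ V]

/- The slope of `z ↦ f (x + z y)` at the origin is `f (y + x / z) - f x / z`, which tends to
`f y` at infinity, so this entire function is affine with slope `f y`. -/
lemma map_add_of_homogeneous {f : V → E}
    (hol : ∀ x y : V, Differentiable ℂ (fun z : ℂ => f (x + z • y)))
    (hom : ∀ (c : ℂ) (y : V), f (c • y) = c • f y) (x y : V) : f (x + y) = f x + f y := by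
  have hinv : Tendsto (fun z : ℂ => z⁻¹) (cobounded ℂ) (𝓝 0) := tendsto_inv₀_cobounded
  have hlim : Tendsto (fun z : ℂ => f (y + z⁻¹ • x) - z⁻¹ • f x) (cobounded ℂ) (𝓝 (f y)) := by
    simpa using (((hol y x).continuous.tendsto 0).comp hinv).sub (hinv.smul_const (f x))
  have hslope : Tendsto (slope (fun z : ℂ => f (x + z • y)) 0) (cobounded ℂ) (𝓝 (f y)) := by
    refine hlim.congr' ?_
    filter_upwards [eventually_ne_cobounded 0] with z hz
    have hxy : x + z • y = z • (y + z⁻¹ • x) := by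
      rw [smul_add, smul_inv_smul₀ hz, add_comm]
    simp only [slope_def_module, sub_zero, zero_smul, add_zero, hxy, hom, smul_sub,
      inv_smul_smul₀ hz]
  have h1 := slope_eq_of_tendsto_cobounded (hol x y) hslope one_ne_zero
  simpa [slope_def_module, sub_eq_iff_eq_add'] using h1

end Liouville

/-! ### The subspace `𝔉⁰` -/

section FHom

variable {V : Type} [AddCommGroup V] [Module ℂ V] [TopologicalSpace V] {ρ : V → S1 → ℂ}

lemma FHom.apply_smul {F : C(ℂ × V, ℂ)} (hF : F ∈ FHom ρ 0) (ζ c : ℂ) (y : V) :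
    F (ζ, c • y) = c * F (ζ, y) := by
  simpa using hF.2 ζ c y

lemma FHom.apply_eq_apply_zero {F : C(ℂ × V, ℂ)} (hF : F ∈ FHom ρ 0) (ζ : ℂ) (y : V) :
    F (ζ, y) = F (0, y) := by
  have hol : Differentiable ℂ (fun z : ℂ => F (z * ζ, y)) := by
    simpa [Prod.smul_mk, smul_eq_mul] using hF.1.1 (0, y) (ζ, 0)
  have hnear : (fun z : ℂ => F (ζ / z, y)) =O[𝓝[≠] 0] (fun _ => (1 : ℂ)) := by
    have h := (isBigO_refl (fun z : ℂ => (z ^ 2)⁻¹) (𝓝[≠] 0)).mul (hF.1.2.1 ζ y)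
    refine h.congr' ?_ ?_ <;>
      filter_upwards [self_mem_nhdsWithin] with z hz
    · rw [FHom.apply_smul hF, inv_mul_cancel_left₀ (pow_ne_zero 2 hz)]
    · exact inv_mul_cancel₀ (pow_ne_zero 2 hz)
  have hbdd : (fun z : ℂ => F (z * ζ, y)) =O[Bornology.cobounded ℂ] (fun _ => (1 : ℂ)) := by
    simpa [Function.comp_def, mul_comm] using hnear.comp_tendsto tendsto_inv₀_cobounded'
  simpa using apply_eq_apply_of_isBigO_one hol hbdd 1 0

/-- The continuous linear form `y ↦ F(0, y)` defined by `F ∈ 𝔉⁰`. -/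
def FHom.toCLM (F : FHom ρ 0) : V →L[ℂ] ℂ where
  toFun y := F.1 (0, y)
  map_add' := map_add_of_homogeneous (f := fun y => F.1 (0, y))
    (fun x y => by simpa [Prod.smul_mk] using F.2.1.1 (0, x) (0, y)) (FHom.apply_smul F.2 0)
  map_smul' := FHom.apply_smul F.2 0
  cont := F.1.continuous.comp (by fun_prop)

lemma IsGFixed.apply_eq_apply_zero {F : C(ℂ × V, ℂ)} (h : IsGFixed F) (ζ : ℂ) (y : V) :
    F (ζ, y) = F (0, y) := by
  simpa using h ⟨!![1, ζ; 0, 1], by simp [Matrix.det_fin_two]⟩ 0 y (by simp)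

lemma IsGFixed.apply_zero_sq_smul {F : C(ℂ × V, ℂ)} (h : IsGFixed F) {a : ℂ} (ha : a ≠ 0)
    (y : V) : F (0, a ^ 2 • y) = a ^ 2 * F (0, y) := by
  have hg := h ⟨!![a⁻¹, 0; 0, a], by simp [Matrix.det_fin_two, ha]⟩ 0 y (by simpa using ha)
  have hg' : F (0, a ^ 2 • y) * (a ^ 2)⁻¹ = F (0, y) := by simpa using hg
  rw [← hg', mul_comm, inv_mul_cancel_right₀ (pow_ne_zero 2 ha)]

lemma IsGFixed.apply_smul {F : C(ℂ × V, ℂ)} (h : IsGFixed F) (ζ c : ℂ) (y : V) :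
    F (ζ, c • y) = c * F (ζ, y) := by
  rw [h.apply_eq_apply_zero, h.apply_eq_apply_zero ζ y]
  obtain ⟨a, rfl⟩ := IsAlgClosed.exists_pow_nat_eq c two_pos
  rcases eq_or_ne a 0 with rfl | ha
  · have h2 : F (0, 0) = 4 * F (0, 0) := by
      simpa [show (2 : ℂ) ^ 2 = 4 by norm_num] using h.apply_zero_sq_smul two_ne_zero 0
    have h0 : F (0, 0) = 0 := by linear_combination -h2 / 3
    simpa using h0
  · exact h.apply_zero_sq_smul ha y

lemma mem_FHom_zero_iff_isGFixed {F : C(ℂ × V, ℂ)} (hF : F ∈ FSpace ρ) :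
    F ∈ FHom ρ 0 ↔ IsGFixed F := by
  refine ⟨fun h g ζ y hne => ?_, fun h => ⟨hF, fun ζ c y => by simpa using h.apply_smul ζ c y⟩⟩
  rw [FHom.apply_smul h, FHom.apply_eq_apply_zero h, ← FHom.apply_eq_apply_zero h ζ, mul_comm,
    inv_mul_cancel_left₀ (pow_ne_zero 2 hne)]

end FHom

/-! ### The isomorphism, from a derivative and a primitive -/

section Quotient

section ModuleQuotient

variable {R M N : Type*} [Ring R] [AddCommGroup M] [Module R M] [TopologicalSpace M]
  [AddCommMonoid N] [Module R N] [TopologicalSpace N] {p : Submodule R M}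
  {T : M →L[R] N} {S : N →L[R] M}

lemma bijective_mkQ_comp_of_rightInverse (hp : ∀ m ∈ p, T m = 0)
    (hTS : Function.RightInverse S T) (hST : ∀ m, S (T m) - m ∈ p) :
    Function.Bijective (p.mkQ ∘ₗ (S : N →ₗ[R] M)) := by
  refine ⟨fun n n' h => ?_, fun x => ?_⟩
  · have hsub : T (S n - S n') = 0 := hp _ ((Submodule.Quotient.eq p).mp h)
    rw [← hTS n, ← hTS n', ← sub_add_cancel (S n) (S n'), map_add, hsub, zero_add]
  · obtain ⟨m, rfl⟩ := Submodule.Quotient.mk_surjective p x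
    exact ⟨T m, (Submodule.Quotient.eq p).mpr (hST m)⟩

lemma exists_quotient_equiv_of_rightInverse (hp : ∀ m ∈ p, T m = 0)
    (hTS : Function.RightInverse S T) (hST : ∀ m, S (T m) - m ∈ p) :
    ∃ e : (M ⧸ p) ≃L[R] N, ∀ m, e (Submodule.Quotient.mk m) = T m := by
  let f := (LinearEquiv.ofBijective _ (bijective_mkQ_comp_of_rightInverse hp hTS hST)).symm
  have hf : ∀ m, f (Submodule.Quotient.mk m) = T m := fun m =>
    (LinearEquiv.symm_apply_eq _).mpr ((Submodule.Quotient.eq p).mpr (hST m)).symm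
  exact ⟨{ f with
    continuous_toFun :=
      p.isQuotientMap_mkQL.continuous_iff.mpr (T.continuous.congr fun m => (hf m).symm)
    continuous_invFun := p.mkQL.continuous.comp S.continuous }, hf⟩

end ModuleQuotient

variable {V W : Type} [AddCommGroup V] [Module ℂ V] [TopologicalSpace V]
  [AddCommGroup W] [Module ℂ W] [TopologicalSpace W] {ρ : V → S1 → ℂ} {σ : W → S1 → ℂ}

lemma finrank_integralLine {I : W →L[ℂ] ℂ} (hI : ∀ x, I x = ∫ t, σ x t) (hI0 : I ≠ 0) :
    Module.finrank ℂ (integralLine σ) = 1 := by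
  refine finrank_eq_one (⟨I, 1, fun x => (hI x).trans (one_mul _).symm⟩ : integralLine σ)
    (fun h => hI0 (congrArg Subtype.val h)) ?_
  rintro ⟨Φ, c, hc⟩
  refine ⟨c, Subtype.ext (UniformConvergenceCLM.ext _ _ fun x => ?_)⟩
  rw [hc, ← hI]
  rfl

lemma isInducing_toContinuousMap :
    IsInducing (fun Φ : W →L_c[ℂ] ℂ => (⟨Φ, map_continuous Φ⟩ : C(W, ℂ))) :=
  (IsInducing.of_comp_iff
      ContinuousMap.isUniformEmbedding_toUniformOnFunIsCompact.isUniformInducing.isInducing).mp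
    (UniformConvergenceCLM.isEmbedding_coeFn _ _ _).isInducing

/-- The function `(ζ, y) ↦ ⟨Φ, D y⟩`, which is `⟨Φ, ẏ⟩` if `D` is the derivative. -/
def pairing (D : V →L[ℂ] W) (Φ : W →L_c[ℂ] ℂ) : C(ℂ × V, ℂ) :=
  ContinuousMap.comp ⟨Φ, map_continuous Φ⟩ ⟨fun q => D q.2, D.continuous.comp continuous_snd⟩

@[simp] lemma pairing_apply (D : V →L[ℂ] W) (Φ : W →L_c[ℂ] ℂ) (q : ℂ × V) :
    pairing D Φ q = Φ (D q.2) := rfl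

variable {D : V →L[ℂ] W}

lemma pairing_mem_FHom
    (hD : ∀ e : V, (∃ c : ℂ, ∀ᵐ t ∂(volume : Measure S1), ρ e t = c) → D e = 0)
    (Φ : W →L_c[ℂ] ℂ) : pairing D Φ ∈ FHom ρ 0 := by
  refine ⟨⟨fun a b => ?_, fun ζ y => ?_, fun ζ x y _ => by simp,
    fun ζ y e he => by simp [hD e he]⟩, fun ζ c y => by simp⟩
  · simp only [pairing_apply, Prod.snd_add, Prod.smul_snd, map_add, map_smul, smul_eq_mul]
    fun_prop
  · simpa using (isBigO_refl (fun z : ℂ => z ^ 2) (𝓝[≠] 0)).mul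
      (isBigO_const_const (Φ (D y)) (one_ne_zero (α := ℂ)) _)

/-- `Φ ↦ pairing D Φ` as an operator from the dual of `W` to `𝔉⁰`. -/
def pairingCLM (hD : ∀ e : V, (∃ c : ℂ, ∀ᵐ t ∂(volume : Measure S1), ρ e t = c) → D e = 0) :
    (W →L_c[ℂ] ℂ) →L[ℂ] FHom ρ 0 where
  toFun Φ := ⟨pairing D Φ, pairing_mem_FHom hD Φ⟩
  map_add' _ _ := rfl
  map_smul' _ _ := rfl
  cont := ((ContinuousMap.continuous_precomp _).comp
    isInducing_toContinuousMap.continuous).subtype_mk _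

/-- The operator `F ↦ F(0, P ·)` from `𝔉⁰` to the dual of `W`. -/
def restrictCLM (P : W →L[ℂ] V) : FHom ρ 0 →L[ℂ] (W →L_c[ℂ] ℂ) where
  toFun F := (FHom.toCLM F).comp P
  map_add' _ _ := rfl
  map_smul' _ _ := rfl
  cont := isInducing_toContinuousMap.continuous_iff.mpr <|
    (ContinuousMap.continuous_precomp (⟨fun x => (0, P x), by fun_prop⟩ : C(W, ℂ × V))).comp
      continuous_subtype_val

/-- A primitive `P` inverts the derivative `D` up to constants and up to the mean; hence
`F ↦ F(0, P ·)` inverts `Φ ↦ ⟨Φ, D ·⟩` up to multiples of the integral. -/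
theorem exists_equiv_FHom {P : W →L[ℂ] V} {I : W →L[ℂ] ℂ} {one : W}
    (hD : ∀ e : V, (∃ c : ℂ, ∀ᵐ t ∂(volume : Measure S1), ρ e t = c) → D e = 0)
    (hI : ∀ x, I x = ∫ t, σ x t) (hID : ∀ y, I (D y) = 0)
    (hDP : ∀ x, D (P x) = x - I x • one)
    (hPD : ∀ y, ∃ c : ℂ, ∀ᵐ t ∂(volume : Measure S1), ρ (P (D y) - y) t = c) :
    ∃ e : ((W →L_c[ℂ] ℂ) ⧸ integralLine σ) ≃L[ℂ] FHom ρ 0,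
      ∀ (Φ : W →L_c[ℂ] ℂ) (ζ : ℂ) (y : V), (e (Submodule.Quotient.mk Φ)).1 (ζ, y) = Φ (D y) := by
  have hker : ∀ Φ ∈ integralLine σ, pairingCLM (ρ := ρ) hD Φ = 0 := by
    rintro Φ ⟨c, hc⟩
    refine Subtype.ext (ContinuousMap.ext fun q => ?_)
    change Φ (D q.2) = 0
    rw [hc, ← hI, hID, mul_zero]
  have hright : Function.RightInverse (restrictCLM (ρ := ρ) P) (pairingCLM hD) := by
    intro F
    refine Subtype.ext (ContinuousMap.ext fun q => ?_)
    change F.1 (0, P (D q.2)) = F.1 (q.1, q.2)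
    rw [FHom.apply_eq_apply_zero F.2 q.1, ← F.2.1.2.2.2 0 q.2 _ (hPD q.2), add_sub_cancel]
  have hleft : ∀ Φ, restrictCLM (ρ := ρ) P (pairingCLM hD Φ) - Φ ∈ integralLine σ := by
    refine fun Φ => ⟨-Φ one, fun x => ?_⟩
    change Φ (D (P x)) - Φ x = _
    rw [hDP, map_sub, map_smul, ← hI, smul_eq_mul]
    ring
  obtain ⟨e, he⟩ := exists_quotient_equiv_of_rightInverse hker hright hleft
  exact ⟨e, fun Φ ζ y => by rw [he]; rfl⟩

end Quotient

/-! ### Spaces of functions with a primitive operator -/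

instance : IsProbabilityMeasure (volume : Measure S1) := ⟨UnitAddCircle.measure_univ⟩

section ClassicalDerivative

/-- `c'` is the derivative of `c`, both continuous on the circle. -/
def HasCircleDeriv (c c' : C(S1, ℂ)) : Prop :=
  ∀ s : ℝ, HasDerivAt (fun s : ℝ => c (s : S1)) (c' (s : S1)) s

lemma IsCk.mono {l l' : ℕ∞} {f : S1 → ℂ} (hf : IsCk l f) (h : l' ≤ l) : IsCk l' f :=
  ContDiff.of_le hf (by exact_mod_cast h)

lemma IsCk.mul {l : ℕ∞} {f g : S1 → ℂ} (hf : IsCk l f) (hg : IsCk l g) : IsCk l (f * g) :=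
  ContDiff.mul hf hg

lemma isCk_const (l : ℕ∞) (c : ℂ) : IsCk l (fun _ => c) :=
  contDiff_const (n := (l : WithTop ℕ∞))

lemma IsCk.hasDerivAt {f : S1 → ℂ} (hf : IsCk 1 f) (s : ℝ) :
    HasDerivAt (fun s : ℝ => f (s : S1)) (LoopSpace.circleDeriv f s) s := by
  rw [congrFun (circleDeriv_coe f) s]
  exact (ContDiff.differentiable hf one_ne_zero s).hasDerivAt

lemma IsCk.exists_hasCircleDeriv {l : ℕ∞} {c : C(S1, ℂ)} (hc : IsCk (l + 1) c) :
    ∃ c' : C(S1, ℂ), HasCircleDeriv c c' ∧ IsCk l c' :=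
  ⟨⟨_, hc.circleDeriv.continuous⟩, (hc.mono le_add_self).hasDerivAt, hc.circleDeriv⟩

end ClassicalDerivative

/-- A normed space `E` of functions on the circle, such as `C(S¹)` or `L^p(S¹)`: `ev u` is the
function that represents `u`, `one` the constant function `1`, `mean u` the integral, and `prim v`
a primitive of `v - mean v`. -/
structure CircleModel (E : Type*) [NormedAddCommGroup E] [NormedSpace ℂ E] where
  ev : E → S1 → ℂ
  HasDeriv : E → E → Prop
  one : E
  mean : E →L[ℂ] ℂ
  prim : E →L[ℂ] E
  ev_ae_eq_const_iff : ∀ {u : E} {c : ℂ},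
    (∀ᵐ t ∂(volume : Measure S1), ev u t = c) ↔ u = c • one
  mean_eq : ∀ u, mean u = ∫ t, ev u t
  hasDeriv_iff : ∀ {u v : E}, HasDeriv u v ↔ mean v = 0 ∧ ∃ c : ℂ, u = prim v + c • one
  hasDeriv_prim : ∀ v, HasDeriv (prim v) (v - mean v • one)
  hasDeriv_unique : ∀ {u v v' : E}, HasDeriv u v → HasDeriv u v' → v = v'

namespace CircleModel

variable {E : Type*} [NormedAddCommGroup E] [NormedSpace ℂ E] {M : CircleModel E}

section Deriv

lemma mean_one : M.mean M.one = 1 := by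
  have h : ∀ᵐ t ∂(volume : Measure S1), M.ev M.one t = 1 :=
    M.ev_ae_eq_const_iff.mpr (one_smul ℂ _).symm
  rw [M.mean_eq, integral_congr_ae h]
  simp

lemma hasDeriv_add {u v u' v' : E} (h : M.HasDeriv u v) (h' : M.HasDeriv u' v') :
    M.HasDeriv (u + u') (v + v') := by
  obtain ⟨h1, c, rfl⟩ := M.hasDeriv_iff.mp h
  obtain ⟨h1', c', rfl⟩ := M.hasDeriv_iff.mp h'
  exact M.hasDeriv_iff.mpr ⟨by simp [h1, h1'], c + c', by rw [map_add, add_smul]; abel⟩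

lemma hasDeriv_smul {u v : E} (a : ℂ) (h : M.HasDeriv u v) : M.HasDeriv (a • u) (a • v) := by
  obtain ⟨h1, c, rfl⟩ := M.hasDeriv_iff.mp h
  exact M.hasDeriv_iff.mpr ⟨by simp [h1], a * c, by rw [map_smul, smul_add, smul_smul]⟩

lemma hasDeriv_smul_one (c : ℂ) : M.HasDeriv (c • M.one) 0 :=
  M.hasDeriv_iff.mpr ⟨map_zero _, c, by simp⟩

end Deriv

section Derivs

variable {X Y : Type} [TopologicalSpace X] [TopologicalSpace Y]

variable (M) in
/-- The derivatives of order at most `n` of the family `u` exist and depend continuously on the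
parameter. -/
def HasDerivsUpTo : ℕ → (X → E) → Prop
  | 0, u => Continuous u
  | n + 1, u => Continuous u ∧ ∃ v : X → E, (∀ x, M.HasDeriv (u x) (v x)) ∧ HasDerivsUpTo n v

lemma HasDerivsUpTo.continuous : ∀ {n : ℕ} {u : X → E}, M.HasDerivsUpTo n u → Continuous u
  | 0, _, h => h
  | _ + 1, _, h => h.1

lemma HasDerivsUpTo.of_succ {n : ℕ} :
    ∀ {u : X → E}, M.HasDerivsUpTo (n + 1) u → M.HasDerivsUpTo n u := by
  induction n with
  | zero => exact fun h => h.1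
  | succ n ih =>
    rintro u ⟨hu, v, huv, hv⟩
    exact ⟨hu, v, huv, ih hv⟩

lemma HasDerivsUpTo.comp {n : ℕ} {g : Y → X} (hg : Continuous g) :
    ∀ {u : X → E}, M.HasDerivsUpTo n u → M.HasDerivsUpTo n (u ∘ g) := by
  induction n with
  | zero => exact fun h => Continuous.comp h hg
  | succ n ih =>
    rintro u ⟨hu, v, huv, hv⟩
    exact ⟨hu.comp hg, v ∘ g, fun x => huv (g x), ih hv⟩

lemma HasDerivsUpTo.add {n : ℕ} : ∀ {u u' : X → E}, M.HasDerivsUpTo n u →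
    M.HasDerivsUpTo n u' → M.HasDerivsUpTo n (fun x => u x + u' x) := by
  induction n with
  | zero => exact fun h h' => Continuous.add h h'
  | succ n ih =>
    rintro u u' ⟨hu, v, huv, hv⟩ ⟨hu', v', huv', hv'⟩
    exact ⟨hu.add hu', _, fun x => M.hasDeriv_add (huv x) (huv' x), ih hv hv'⟩

lemma HasDerivsUpTo.deriv {n : ℕ} {u v : X → E} (h : M.HasDerivsUpTo (n + 1) u)
    (huv : ∀ x, M.HasDeriv (u x) (v x)) : M.HasDerivsUpTo n v := by
  obtain ⟨-, v', huv', hv'⟩ := h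
  rwa [show v = v' from funext fun x => M.hasDeriv_unique (huv x) (huv' x)]

lemma hasDerivsUpTo_smul_one (n : ℕ) {c : X → ℂ} (hc : Continuous c) :
    M.HasDerivsUpTo n (fun x => c x • M.one) := by
  induction n generalizing c with
  | zero => exact hc.smul continuous_const
  | succ n ih =>
    refine ⟨hc.smul continuous_const, fun _ => (0 : ℂ) • M.one, fun x => ?_,
      ih continuous_const⟩
    simpa using M.hasDeriv_smul_one (c x)

lemma HasDerivsUpTo.prim {n : ℕ} {u : X → E} (h : M.HasDerivsUpTo n u) :
    M.HasDerivsUpTo (n + 1) (fun x => M.prim (u x)) := by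
  refine ⟨M.prim.continuous.comp h.continuous, _, fun x => M.hasDeriv_prim (u x), ?_⟩
  simpa [sub_eq_add_neg] using
    h.add (M.hasDerivsUpTo_smul_one n (M.mean.continuous.comp h.continuous).neg)

variable (M) in
/-- `HasDerivsUpTo` for a possibly infinite number `l` of derivatives. -/
def HasDerivs (l : ℕ∞) (u : X → E) : Prop :=
  ∀ n : ℕ, (n : ℕ∞) ≤ l → M.HasDerivsUpTo n u

variable {l : ℕ∞} {u v : X → E}

lemma HasDerivs.continuous (h : M.HasDerivs l u) : Continuous u := h 0 (by simp)

lemma HasDerivs.comp {g : Y → X} (hg : Continuous g) (h : M.HasDerivs l u) :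
    M.HasDerivs l (u ∘ g) :=
  fun n hn => (h n hn).comp hg

lemma HasDerivs.deriv (h : M.HasDerivs (l + 1) u) (huv : ∀ x, M.HasDeriv (u x) (v x)) :
    M.HasDerivs l v :=
  fun n hn => (h (n + 1) (by push_cast; gcongr)).deriv huv

lemma HasDerivs.prim (h : M.HasDerivs l u) : M.HasDerivs (l + 1) (fun x => M.prim (u x)) := by
  rintro (_ | n) hn
  · exact M.prim.continuous.comp h.continuous
  · exact (h n ((ENat.add_le_add_iff_right ENat.one_ne_top).mp (by exact_mod_cast hn))).prim

lemma hasDerivs_one : M.HasDerivs l (fun _ : X => M.one) := fun n _ => by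
  simpa using M.hasDerivsUpTo_smul_one n (continuous_const : Continuous fun _ : X => (1 : ℂ))

end Derivs

section Pullback

/-- The operators `u ↦ c · (u ∘ h)` on `E`, where `h` is a map of the circle with derivative
`θ`. -/
structure Pullback (M : CircleModel E) (h : S1 → S1) (θ : C(S1, ℂ)) where
  op : C(S1, ℂ) → E →L[ℂ] E
  ev_op : ∀ c u, ∀ᵐ t ∂(volume : Measure S1), M.ev (op c u) t = c t * M.ev u (h t)
  hasDeriv_op : ∀ {c c' : C(S1, ℂ)} {u v : E}, HasCircleDeriv c c' → M.HasDeriv u v →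
    M.HasDeriv (op c u) (op c' u + op (c * θ) v)

variable {h : S1 → S1} {θ : C(S1, ℂ)} (Q : M.Pullback h θ) {X : Type} [TopologicalSpace X]

lemma Pullback.op_zero_apply (u : E) : Q.op 0 u = 0 := by
  have h0 : ∀ᵐ t ∂(volume : Measure S1), M.ev (Q.op 0 u) t = 0 := by
    filter_upwards [Q.ev_op 0 u] with t ht
    rw [ht, ContinuousMap.zero_apply, zero_mul]
  simpa using M.ev_ae_eq_const_iff.mp h0

lemma Pullback.hasDeriv_op_one {u v : E} (huv : M.HasDeriv u v) :
    M.HasDeriv (Q.op 1 u) (Q.op θ v) := by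
  have h1 : HasCircleDeriv 1 0 := fun s => hasDerivAt_const s (1 : ℂ)
  simpa [Q.op_zero_apply] using Q.hasDeriv_op h1 huv

lemma Pullback.hasDerivsUpTo {n : ℕ} {c : C(S1, ℂ)} {u : X → E} (hc : IsCk n c)
    (hθ : IsCk (n - 1 : ℕ) θ) (hu : M.HasDerivsUpTo n u) :
    M.HasDerivsUpTo n (fun x => Q.op c (u x)) := by
  induction n generalizing c u with
  | zero => exact (Q.op c).continuous.comp hu
  | succ n ih =>
    obtain ⟨c', hcc', hc'⟩ := IsCk.exists_hasCircleDeriv (l := n) (by exact_mod_cast hc)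
    obtain ⟨v, huv, hv⟩ := hu.2
    have hθ' : IsCk (n - 1 : ℕ) θ := hθ.mono (by exact_mod_cast Nat.sub_le n 1)
    have hcθ : IsCk n (c * θ) := (hc.mono (by exact_mod_cast n.le_succ)).mul hθ
    exact ⟨(Q.op c).continuous.comp hu.continuous, _, fun x => Q.hasDeriv_op hcc' (huv x),
      (ih hc' hθ' hu.of_succ).add (ih hcθ hθ' hv)⟩

lemma Pullback.hasDerivs {l : ℕ∞} {c : C(S1, ℂ)} {u : X → E} (hc : IsCk l c)
    (hθ : IsCk (l - 1) θ) (hu : M.HasDerivs l u) : M.HasDerivs l (fun x => Q.op c (u x)) :=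
  fun n hn => Q.hasDerivsUpTo (hc.mono hn)
    (hθ.mono (by push_cast; exact tsub_le_tsub_right hn 1)) (hu n hn)

end Pullback

/-- `V`, with the functions `ρ x` representing its elements, is embedded by `ι` as the space of the
elements of `E` with `l` derivatives. -/
structure Realizes (M : CircleModel E) (l : ℕ∞) {V : Type} [AddCommGroup V] [Module ℂ V]
    [TopologicalSpace V] (ρ : V → S1 → ℂ) (ι : V →ₗ[ℂ] E) : Prop where
  injective : Function.Injective ι
  eq_ev : ∀ x, ρ x = M.ev (ι x)
  exists_of_hasDerivs : ∀ u : E, M.HasDerivs l (fun _ : Unit => u) → ∃ x, ι x = u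
  continuous_iff : ∀ {X : Type} [TopologicalSpace X] (T : X → V),
    Continuous T ↔ M.HasDerivs l (fun x => ι (T x))

namespace Realizes

variable {l : ℕ∞} {V W : Type} [AddCommGroup V] [Module ℂ V] [TopologicalSpace V]
  [AddCommGroup W] [Module ℂ W] [TopologicalSpace W] {ρ : V → S1 → ℂ} {σ : W → S1 → ℂ}
  {ι : V →ₗ[ℂ] E} {κ : W →ₗ[ℂ] E}

lemma hasDerivs (hV : M.Realizes l ρ ι) : M.HasDerivs l ι :=
  (hV.continuous_iff id).mp continuous_id

lemma exists_lift (hV : M.Realizes l ρ ι) (f : W →ₗ[ℂ] E) (hf : M.HasDerivs l f) :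
    ∃ T : W →L[ℂ] V, ∀ x, ι (T x) = f x := by
  choose T hT using fun x => hV.exists_of_hasDerivs (f x)
    (hf.comp (continuous_const : Continuous fun _ : Unit => x))
  refine ⟨⟨⟨⟨T, fun x y => hV.injective ?_⟩, fun c x => hV.injective ?_⟩, ?_⟩, hT⟩
  · simp [hT]
  · simp [hT]
  · exact (hV.continuous_iff T).mpr (by simpa [hT] using hf)

lemma ae_eq_const_iff (hV : M.Realizes l ρ ι) {y : V} {c : ℂ} :
    (∀ᵐ t ∂(volume : Measure S1), ρ y t = c) ↔ ι y = c • M.one := by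
  rw [hV.eq_ev, M.ev_ae_eq_const_iff]

/-- The integral, as a continuous linear form. -/
def integral (hV : M.Realizes l ρ ι) : V →L[ℂ] ℂ :=
  M.mean.comp ⟨ι, hV.hasDerivs.continuous⟩

lemma integral_eq (hV : M.Realizes l ρ ι) (x : V) : hV.integral x = ∫ t, ρ x t := by
  rw [hV.eq_ev, ← M.mean_eq]
  rfl

lemma exists_one (hV : M.Realizes l ρ ι) : ∃ one : V, ι one = M.one :=
  hV.exists_of_hasDerivs _ hasDerivs_one

lemma integral_ne_zero (hV : M.Realizes l ρ ι) : hV.integral ≠ 0 := by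
  obtain ⟨one, hone⟩ := hV.exists_one
  intro h
  have h1 : M.mean (ι one) = 0 := DFunLike.congr_fun h one
  rw [hone, M.mean_one] at h1
  exact one_ne_zero h1

variable {dot : V → W}

/-- Differentiation `V → W`, as a continuous linear operator. -/
def dotCLM (hV : M.Realizes (l + 1) ρ ι) (hW : M.Realizes l σ κ)
    (hdot : ∀ y, M.HasDeriv (ι y) (κ (dot y))) : V →L[ℂ] W where
  toFun := dot
  map_add' x y := hW.injective <| M.hasDeriv_unique (hdot (x + y)) <| by
    simpa using M.hasDeriv_add (hdot x) (hdot y)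
  map_smul' c x := hW.injective <| M.hasDeriv_unique (hdot (c • x)) <| by
    simpa using M.hasDeriv_smul c (hdot x)
  cont := (hW.continuous_iff dot).mpr (hV.hasDerivs.deriv hdot)

theorem exists_equiv (hV : M.Realizes (l + 1) ρ ι) (hW : M.Realizes l σ κ)
    (hdot : ∀ y, M.HasDeriv (ι y) (κ (dot y))) :
    ∃ e : ((W →L_c[ℂ] ℂ) ⧸ integralLine σ) ≃L[ℂ] FHom ρ 0,
      ∀ (Φ : W →L_c[ℂ] ℂ) (ζ : ℂ) (y : V),
        (e (Submodule.Quotient.mk Φ)).1 (ζ, y) = Φ (dot y) := by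
  obtain ⟨P, hP⟩ := hV.exists_lift ((M.prim : E →ₗ[ℂ] E) ∘ₗ κ) hW.hasDerivs.prim
  replace hP : ∀ x, ι (P x) = M.prim (κ x) := hP
  obtain ⟨one, hone⟩ := hW.exists_one
  refine exists_equiv_FHom (D := hV.dotCLM hW hdot) (P := P) (I := hW.integral) (one := one)
    ?_ hW.integral_eq (fun y => (M.hasDeriv_iff.mp (hdot y)).1) ?_ ?_
  · rintro e ⟨c, hc⟩
    have hec := hdot e
    rw [hV.ae_eq_const_iff.mp hc] at hec
    exact hW.injective (M.hasDeriv_unique hec (by simpa using M.hasDeriv_smul_one c))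
  · intro x
    refine hW.injective (M.hasDeriv_unique (hdot (P x)) ?_)
    rw [hP, map_sub, map_smul, hone]
    exact M.hasDeriv_prim (κ x)
  · intro y
    obtain ⟨-, c, hc⟩ := M.hasDeriv_iff.mp (hdot y)
    refine ⟨-c, hV.ae_eq_const_iff.mpr ?_⟩
    rw [map_sub, hP, hc, neg_smul]
    exact sub_add_cancel_left _ _

lemma exists_pullbacks (hV : M.Realizes (l + 1) ρ ι) (hW : M.Realizes l σ κ)
    (hdot : ∀ y, M.HasDeriv (ι y) (κ (dot y))) {h : S1 → S1} {θ : C(S1, ℂ)}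
    (Q : M.Pullback h θ) (hθ : IsCk l θ) : ∃ (A : V →L[ℂ] V) (B : W →L[ℂ] W),
      (∀ y, ∀ᵐ t ∂(volume : Measure S1), ρ (A y) t = ρ y (h t)) ∧
      (∀ x, ∀ᵐ t ∂(volume : Measure S1), σ (B x) t = σ x (h t) * θ t) ∧
      ∀ y, dot (A y) = B (dot y) := by
  obtain ⟨A, hA⟩ := hV.exists_lift ((Q.op 1 : E →ₗ[ℂ] E) ∘ₗ ι)
    (Q.hasDerivs (isCk_const _ 1) (hθ.mono (tsub_le_iff_right.mpr le_rfl)) hV.hasDerivs)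
  obtain ⟨B, hB⟩ := hW.exists_lift ((Q.op θ : E →ₗ[ℂ] E) ∘ₗ κ)
    (Q.hasDerivs hθ (hθ.mono tsub_le_self) hW.hasDerivs)
  replace hA : ∀ y, ι (A y) = Q.op 1 (ι y) := hA
  replace hB : ∀ x, κ (B x) = Q.op θ (κ x) := hB
  refine ⟨A, B, fun y => ?_, fun x => ?_, fun y => hW.injective ?_⟩
  · filter_upwards [Q.ev_op 1 (ι y)] with t ht
    rw [hV.eq_ev, hV.eq_ev, hA, ht, ContinuousMap.one_apply, one_mul]
  · filter_upwards [Q.ev_op θ (κ x)] with t ht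
    rw [hW.eq_ev, hW.eq_ev, hB, ht, mul_comm]
  · refine M.hasDeriv_unique (hdot (A y)) ?_
    rw [hA, hB]
    exact Q.hasDeriv_op_one (hdot y)

theorem exists_equivariant_equiv (hV : M.Realizes (l + 1) ρ ι) (hW : M.Realizes l σ κ)
    (hdot : ∀ y, M.HasDeriv (ι y) (κ (dot y))) {k : ℕ∞}
    (hQ : ∀ φ : CircleDiffeo k, ∃ θ : C(S1, ℂ), (∀ t, θ t = φ.deriv t) ∧ IsCk l θ ∧
      Nonempty (M.Pullback φ.toHomeomorph θ)) :
    (∀ F ∈ FSpace ρ, F ∈ FHom ρ 0 ↔ IsGFixed F) ∧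
    Module.finrank ℂ (integralLine σ) = 1 ∧
    ∃ e : ((W →L_c[ℂ] ℂ) ⧸ integralLine σ) ≃L[ℂ] FHom ρ 0,
      (∀ (Φ : W →L_c[ℂ] ℂ) (ζ : ℂ) (y : V),
        (e (Submodule.Quotient.mk Φ)).1 (ζ, y) = Φ (dot y)) ∧
      ∀ φ : CircleDiffeo k, ∃ (A : V →L[ℂ] V) (B : W →L[ℂ] W),
        IsFunctionPullback φ ρ A ∧ IsFormPullback φ σ B ∧
        ∀ Φ Ψ : W →L_c[ℂ] ℂ, (∀ x, Ψ x = Φ (B x)) → ∀ (ζ : ℂ) (y : V),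
          (e (Submodule.Quotient.mk Ψ)).1 (ζ, y) = (e (Submodule.Quotient.mk Φ)).1 (ζ, A y) := by
  obtain ⟨e, he⟩ := hV.exists_equiv hW hdot
  refine ⟨fun F hF => mem_FHom_zero_iff_isGFixed hF,
    finrank_integralLine hW.integral_eq hW.integral_ne_zero, e, he, fun φ => ?_⟩
  obtain ⟨θ, hθ, hθl, ⟨Q⟩⟩ := hQ φ
  obtain ⟨A, B, hA, hB, hAB⟩ := hV.exists_pullbacks hW hdot Q hθl
  refine ⟨A, B, hA, fun x => ?_, fun Φ Ψ hΨ ζ y => ?_⟩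
  · simpa only [hθ] using hB x
  · rw [he, he, hΨ, hAB]

end Realizes

end CircleModel

/-! ### Primitives of integrable functions -/

section Primitive

lemma exists_coe_Icc (t : S1) : ∃ s ∈ Set.Icc (0 : ℝ) 1, (s : S1) = t := by
  obtain ⟨s, hs, hst⟩ := (AddCircle.coe_image_Icc_eq (1 : ℝ) 0).symm.subset (Set.mem_univ t)
  exact ⟨s, by simpa only [zero_add] using hs, hst⟩

lemma ae_coe {q : S1 → Prop} (h : ∀ᵐ t ∂(volume : Measure S1), q t) : ∀ᵐ s : ℝ, q (s : S1) := by
  have hIoc : ∀ n : ℤ, ∀ᵐ s : ℝ ∂(volume.restrict (Set.Ioc (n : ℝ) (n + 1))), q (s : S1) :=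
    fun n => (UnitAddCircle.measurePreserving_mk (n : ℝ)).quasiMeasurePreserving.ae h
  rw [← Measure.restrict_univ (μ := (volume : Measure ℝ)), ← iUnion_Ioc_intCast]
  exact (ae_restrict_iUnion_iff _ _).mpr hIoc

/-- The lift to `ℝ` of the primitive of `f - ∫ f` that vanishes at the origin. -/
def primFun (f : S1 → ℂ) (s : ℝ) : ℂ := ∫ u in (0 : ℝ)..s, (f (u : S1) - ∫ t, f t)

variable {f g : S1 → ℂ}

lemma primFun_congr (h : f =ᵐ[volume] g) : primFun f = primFun g := by
  funext s
  rw [primFun, primFun, integral_congr_ae h]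
  refine intervalIntegral.integral_congr_ae ?_
  filter_upwards [ae_coe h] with u hu _
  rw [hu]

lemma intervalIntegrable_coe (hf : Integrable f volume) (a b : ℝ) :
    IntervalIntegrable (fun s : ℝ => f (s : S1)) volume a b := by
  have hper : Function.Periodic (fun s : ℝ => f (s : S1)) 1 := fun s => by simp
  refine hper.intervalIntegrable one_ne_zero (t := 0) ?_ a b
  rw [intervalIntegrable_iff_integrableOn_Ioc_of_le (by simp)]
  exact (UnitAddCircle.measurePreserving_mk 0).integrable_comp_of_integrable hf

lemma intervalIntegrable_coe_sub_const (hf : Integrable f volume) (c : ℂ) (a b : ℝ) :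
    IntervalIntegrable (fun s : ℝ => f (s : S1) - c) volume a b :=
  (intervalIntegrable_coe hf a b).sub intervalIntegrable_const

lemma primFun_add (hf : Integrable f volume) (hg : Integrable g volume) :
    primFun (f + g) = primFun f + primFun g := by
  funext s
  rw [Pi.add_apply, primFun, primFun, primFun,
    ← intervalIntegral.integral_add (intervalIntegrable_coe_sub_const hf _ _ _)
      (intervalIntegrable_coe_sub_const hg _ _ _)]
  simp only [Pi.add_apply, integral_add hf hg, add_sub_add_comm]

lemma primFun_smul (c : ℂ) (f : S1 → ℂ) : primFun (c • f) = c • primFun f := by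
  funext s
  simp only [primFun, Pi.smul_apply, integral_smul, ← smul_sub, intervalIntegral.integral_smul]

lemma primFun_periodic (hf : Integrable f volume) : Function.Periodic (primFun f) 1 := by
  intro s
  have h : primFun f (s + 1) - primFun f s = ∫ u in s..(s + 1), (f (u : S1) - ∫ t, f t) :=
    intervalIntegral.integral_interval_sub_left (intervalIntegrable_coe_sub_const hf _ _ _)
      (intervalIntegrable_coe_sub_const hf _ _ _)
  rw [UnitAddCircle.intervalIntegral_preimage s (fun u => f u - ∫ t, f t),
    integral_sub hf (integrable_const _)] at h
  simpa [sub_eq_zero] using h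

lemma norm_primFun_le (hf : Integrable f volume) {s : ℝ} (hs : s ∈ Set.Icc (0 : ℝ) 1) :
    ‖primFun f s‖ ≤ 2 * ∫ t, ‖f t‖ := by
  calc ‖primFun f s‖ ≤ ∫ u in (0 : ℝ)..s, ‖f (u : S1) - ∫ t, f t‖ :=
        intervalIntegral.norm_integral_le_integral_norm hs.1
    _ ≤ ∫ u in (0 : ℝ)..(0 + 1), ‖f (u : S1) - ∫ t, f t‖ :=
        intervalIntegral.integral_mono_interval le_rfl hs.1 (by simpa using hs.2)
          (ae_of_all _ fun u => norm_nonneg _) (intervalIntegrable_coe_sub_const hf _ _ _).norm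
    _ = ∫ t, ‖f t - ∫ t, f t‖ :=
        UnitAddCircle.intervalIntegral_preimage 0 (fun u => ‖f u - ∫ t, f t‖)
    _ ≤ ∫ t, (‖f t‖ + ∫ t, ‖f t‖) := by
        refine integral_mono (hf.sub (integrable_const _)).norm
          (hf.norm.add (integrable_const _)) fun t => (norm_sub_le _ _).trans ?_
        gcongr
        exact norm_integral_le_integral_norm _
    _ = 2 * ∫ t, ‖f t‖ := by
        rw [integral_add hf.norm (integrable_const _), integral_const, probReal_univ, one_smul,
          two_mul]

/-- The primitive of `f - ∫ f` that vanishes at the origin. -/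
def primitive (f : S1 → ℂ) (hf : Integrable f volume) : C(S1, ℂ) where
  toFun := (primFun_periodic hf).lift
  continuous_toFun := continuous_of_coe <| intervalIntegral.continuous_primitive
    (fun a b => intervalIntegrable_coe_sub_const hf _ a b) 0

lemma primitive_coe (hf : Integrable f volume) (s : ℝ) : primitive f hf (s : S1) = primFun f s :=
  (primFun_periodic hf).lift_coe s

lemma norm_primitive_le (hf : Integrable f volume) : ‖primitive f hf‖ ≤ 2 * ∫ t, ‖f t‖ := by
  refine (ContinuousMap.norm_le _ (by positivity)).mpr fun t => ?_
  obtain ⟨s, hs, rfl⟩ := exists_coe_Icc t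
  rw [primitive_coe]
  exact norm_primFun_le hf hs

end Primitive

section Lp

variable {p : ℝ≥0∞} [Fact (1 ≤ p)]

lemma integrable_Lp (u : Lp ℂ p (volume : Measure S1)) : Integrable u volume :=
  (Lp.memLp u).integrable Fact.out

lemma integral_norm_le_norm (u : Lp ℂ p (volume : Measure S1)) : ∫ t, ‖u t‖ ≤ ‖u‖ := by
  rw [integral_norm_eq_lintegral_enorm (Lp.aestronglyMeasurable u), Lp.norm_def,
    ← eLpNorm_one_eq_lintegral_enorm]
  exact ENNReal.toReal_mono (Lp.eLpNorm_ne_top u)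
    (eLpNorm_le_eLpNorm_of_exponent_le Fact.out (Lp.aestronglyMeasurable u))

variable (p) in
/-- The inclusion of the continuous functions into `L^p`. -/
abbrev incl : C(S1, ℂ) →L[ℂ] Lp ℂ p (volume : Measure S1) := ContinuousMap.toLp p volume ℂ

lemma incl_ae (c : C(S1, ℂ)) : incl p c =ᵐ[volume] c := ContinuousMap.coeFn_toLp volume c

instance : Fact (1 ≤ p.conjExponent) := ⟨ENNReal.HolderConjugate.one_le p.conjExponent p⟩

variable (p) in
/-- The pairing `(u, c) ↦ ∫ u c` of `L^p` with the continuous functions. -/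
def pairLp : Lp ℂ p (volume : Measure S1) →L[ℂ] C(S1, ℂ) →L[ℂ] ℂ :=
  ((ContinuousLinearMap.mul ℂ ℂ).lpPairing volume p p.conjExponent).bilinearComp
    (.id ℂ _) (incl p.conjExponent)

lemma pairLp_apply (u : Lp ℂ p (volume : Measure S1)) (c : C(S1, ℂ)) :
    pairLp p u c = ∫ t, u t * c t := by
  refine (ContinuousLinearMap.lpPairing_eq_integral _ u (incl _ c)).trans (integral_congr_ae ?_)
  filter_upwards [incl_ae (p := p.conjExponent) c] with t ht
  rw [ht, ContinuousLinearMap.mul_apply']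

lemma pairLp_incl (u c : C(S1, ℂ)) : pairLp p (incl p u) c = ∫ t, u t * c t := by
  rw [pairLp_apply]
  refine integral_congr_ae ?_
  filter_upwards [incl_ae (p := p) u] with t ht
  rw [ht]

variable (p) in
/-- The integral on `L^p`. -/
def meanLp : Lp ℂ p (volume : Measure S1) →L[ℂ] ℂ := (pairLp p).flip 1

lemma meanLp_apply (u : Lp ℂ p (volume : Measure S1)) : meanLp p u = ∫ t, u t := by
  simp [meanLp, pairLp_apply]

lemma meanLp_incl (u : C(S1, ℂ)) : meanLp p (incl p u) = ∫ t, u t := by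
  rw [meanLp_apply, integral_congr_ae (incl_ae u)]

variable (p) in
/-- `primitive`, as an operator on `L^p`. -/
def primLp : Lp ℂ p (volume : Measure S1) →L[ℂ] C(S1, ℂ) :=
  LinearMap.mkContinuous
    { toFun := fun u => primitive u (integrable_Lp u)
      map_add' := fun u v => by
        ext t
        obtain ⟨s, -, rfl⟩ := exists_coe_Icc t
        rw [ContinuousMap.add_apply, primitive_coe, primitive_coe, primitive_coe,
          primFun_congr (Lp.coeFn_add u v), primFun_add (integrable_Lp u) (integrable_Lp v),
          Pi.add_apply]
      map_smul' := fun a u => by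
        ext t
        obtain ⟨s, -, rfl⟩ := exists_coe_Icc t
        rw [ContinuousMap.smul_apply, primitive_coe, primitive_coe,
          primFun_congr (Lp.coeFn_smul a u), primFun_smul, Pi.smul_apply, RingHom.id_apply] }
    2 fun u => (norm_primitive_le (integrable_Lp u)).trans <| by
      gcongr
      exact integral_norm_le_norm u

lemma primLp_incl_coe (u : C(S1, ℂ)) (s : ℝ) :
    primLp p (incl p u) (s : S1) = primFun u s := by
  rw [← primFun_congr (incl_ae (p := p) u)]
  exact primitive_coe (integrable_Lp _) s

end Lp

/-! ### Continuous functions with the classical derivative -/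

section Continuous

/-- The integral of continuous functions. -/
def meanC : C(S1, ℂ) →L[ℂ] ℂ := (meanLp 1).comp (incl 1)

lemma meanC_apply (u : C(S1, ℂ)) : meanC u = ∫ t, u t := meanLp_incl u

/-- `primitive`, as an operator on the continuous functions. -/
def primC : C(S1, ℂ) →L[ℂ] C(S1, ℂ) := (primLp 1).comp (incl 1)

lemma primC_coe (u : C(S1, ℂ)) (s : ℝ) : primC u (s : S1) = primFun u s := primLp_incl_coe u s

lemma primLp_incl {p : ℝ≥0∞} [Fact (1 ≤ p)] (u : C(S1, ℂ)) : primLp p (incl p u) = primC u := by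
  ext t
  obtain ⟨s, -, rfl⟩ := exists_coe_Icc t
  rw [primLp_incl_coe, primC_coe]

lemma continuous_coe (u : C(S1, ℂ)) : Continuous fun s : ℝ => u (s : S1) :=
  u.continuous.comp (AddCircle.continuous_mk' 1)

lemma hasCircleDeriv_primC (v : C(S1, ℂ)) : HasCircleDeriv (primC v) (v - meanC v • 1) := by
  intro s
  have hv : Continuous fun u : ℝ => v (u : S1) - ∫ t, v t :=
    (continuous_coe v).sub continuous_const
  simp only [primC_coe]
  simpa [meanC_apply] using! (hv.integral_hasStrictDerivAt 0 s).hasDerivAt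

lemma hasCircleDeriv_const (c : ℂ) : HasCircleDeriv (c • 1) 0 :=
  fun s => hasDerivAt_const s (c • (1 : ℂ))

namespace HasCircleDeriv

variable {u v v' : C(S1, ℂ)}

lemma circleDeriv_eq (h : HasCircleDeriv u v) : circleDeriv u = v := by
  funext t
  obtain ⟨s, -, rfl⟩ := exists_coe_Icc t
  exact (congrFun (circleDeriv_coe u) s).trans (h s).deriv

lemma unique (h : HasCircleDeriv u v) (h' : HasCircleDeriv u v') : v = v' :=
  DFunLike.coe_injective (h.circleDeriv_eq.symm.trans h'.circleDeriv_eq)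

lemma add {u' : C(S1, ℂ)} (h : HasCircleDeriv u v) (h' : HasCircleDeriv u' v') :
    HasCircleDeriv (u + u') (v + v') :=
  fun s => (h s).add (h' s)

lemma mul {u' : C(S1, ℂ)} (h : HasCircleDeriv u v) (h' : HasCircleDeriv u' v') :
    HasCircleDeriv (u * u') (v * u' + u * v') :=
  fun s => (h s).mul (h' s)

lemma integral_eq_sub (h : HasCircleDeriv u v) (a b : ℝ) :
    ∫ s in a..b, v (s : S1) = u (b : S1) - u (a : S1) :=
  intervalIntegral.integral_eq_sub_of_hasDerivAt (fun s _ => h s)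
    ((continuous_coe v).intervalIntegrable a b)

lemma integral_eq_zero (h : HasCircleDeriv u v) : ∫ t, v t = 0 := by
  rw [← UnitAddCircle.intervalIntegral_preimage 0, h.integral_eq_sub, AddCircle.coe_add_period,
    sub_self]

lemma eq_primC_add (h : HasCircleDeriv u v) : u = primC v + u 0 • 1 := by
  ext t
  obtain ⟨s, -, rfl⟩ := exists_coe_Icc t
  rw [ContinuousMap.add_apply, primC_coe, primFun]
  simp only [h.integral_eq_zero, sub_zero, h.integral_eq_sub 0 s]
  simp

end HasCircleDeriv

lemma hasCircleDeriv_iff {u v : C(S1, ℂ)} :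
    HasCircleDeriv u v ↔ meanC v = 0 ∧ ∃ c : ℂ, u = primC v + c • 1 := by
  refine ⟨fun h => ⟨(meanC_apply v).trans h.integral_eq_zero, _, h.eq_primC_add⟩, ?_⟩
  rintro ⟨hv, c, rfl⟩
  have h := (hasCircleDeriv_primC v).add (hasCircleDeriv_const c)
  have h0 : (0 : ℂ) • (1 : C(S1, ℂ)) = 0 := by
    ext
    simp
  rwa [hv, h0, sub_zero, add_zero] at h

lemma ae_eq_const_iff {u : C(S1, ℂ)} {c : ℂ} :
    (∀ᵐ t ∂(volume : Measure S1), u t = c) ↔ u = c • 1 := by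
  have h := Continuous.ae_eq_iff_eq (volume : Measure S1) u.continuous
    (c • (1 : C(S1, ℂ))).continuous
  simpa [EventuallyEq] using h.trans DFunLike.coe_injective.eq_iff

/-- The continuous functions, with the classical derivative. -/
def modelC : CircleModel C(S1, ℂ) where
  ev u := u
  HasDeriv := HasCircleDeriv
  one := 1
  mean := meanC
  prim := primC
  ev_ae_eq_const_iff := ae_eq_const_iff
  mean_eq := meanC_apply
  hasDeriv_iff := hasCircleDeriv_iff
  hasDeriv_prim := hasCircleDeriv_primC
  hasDeriv_unique := HasCircleDeriv.unique

lemma HasCircleDeriv.isCk_succ {l : ℕ∞} {u v : C(S1, ℂ)} (h : HasCircleDeriv u v)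
    (hv : IsCk l v) : IsCk (l + 1) u := by
  have hd : deriv (fun s : ℝ => u (s : S1)) = fun s : ℝ => v (s : S1) :=
    funext fun s => (h s).deriv
  have hu : ContDiff ℝ ((l : WithTop ℕ∞) + 1) (fun s : ℝ => u (s : S1)) :=
    contDiff_succ_iff_deriv.mpr ⟨fun s => (h s).differentiableAt, by simp, by rwa [hd]⟩
  exact_mod_cast hu

lemma isCk_fourier (n : ℤ) : IsCk ⊤ (fourier n : C(S1, ℂ)) := by
  unfold IsCk
  simp only [fourier_coe_apply]
  have : ContDiff ℝ ((⊤ : ℕ∞) : WithTop ℕ∞) (fun s : ℝ => (s : ℂ)) := Complex.ofRealCLM.contDiff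
  fun_prop

lemma isCk_primC {ψ : C(S1, ℂ)} (hψ : IsCk ⊤ ψ) : IsCk ⊤ (primC ψ) :=
  (hasCircleDeriv_primC ψ).isCk_succ (l := ⊤) (ContDiff.sub hψ (isCk_const ⊤ (meanC ψ • 1)))

end Continuous

/-! ### `L^p` functions with the weak derivative -/

section Weak

open scoped Manifold in
/- The smooth functions on a manifold determine an integrable function; the manifold here is the
unit circle in `ℂ`. -/
lemma ae_eq_zero_of_forall_integral_mul_eq_zero {f : S1 → ℂ} (hf : Integrable f volume)
    (h : ∀ c : C(S1, ℂ), ∫ t, f t * c t = 0) : ∀ᵐ t ∂(volume : Measure S1), f t = 0 := by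
  borelize Circle
  let e : S1 ≃ₜ Circle := AddCircle.homeomorphCircle one_ne_zero
  have he : MeasurableEmbedding e := e.measurableEmbedding
  have hfe : Integrable (f ∘ e.symm) (volume.map e) := by
    rw [he.integrable_map_iff]
    simpa [Function.comp_def] using hf
  have h0 : ∀ᵐ z ∂(volume.map e), (f ∘ e.symm) z = 0 := by
    refine ae_eq_zero_of_integral_contMDiff_smul_eq_zero (𝓡 1) hfe.locallyIntegrable
      fun g hg _ => ?_
    have hge : Continuous fun t => (g (e t) : ℂ) :=
      Complex.continuous_ofReal.comp (hg.continuous.comp e.continuous)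
    rw [he.integral_map]
    simpa [mul_comm] using h ⟨_, hge⟩
  rw [he.ae_map_iff] at h0
  simpa using h0

variable {p : ℝ≥0∞} [Fact (1 ≤ p)]

lemma eq_zero_of_forall_smooth {u : Lp ℂ p (volume : Measure S1)}
    (h : ∀ φ : C(S1, ℂ), IsCk ⊤ φ → pairLp p u φ = 0) : u = 0 := by
  have hle : (Submodule.span ℂ (Set.range (@fourier 1))).topologicalClosure ≤
      LinearMap.ker (pairLp p u : C(S1, ℂ) →ₗ[ℂ] ℂ) := by
    refine Submodule.topologicalClosure_minimal _ (Submodule.span_le.mpr ?_)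
      (pairLp p u).isClosed_ker
    rintro _ ⟨n, rfl⟩
    exact h _ (isCk_fourier n)
  rw [span_fourier_closure_eq_top] at hle
  rw [Lp.eq_zero_iff_ae_eq_zero]
  exact ae_eq_zero_of_forall_integral_mul_eq_zero (integrable_Lp u) fun c =>
    (pairLp_apply u c).symm.trans (hle Submodule.mem_top)

lemma hasWeakDeriv_iff_pairLp {u v : Lp ℂ p (volume : Measure S1)} :
    HasWeakDeriv u v ↔ ∀ φ φ' : C(S1, ℂ), IsCk ⊤ φ → HasCircleDeriv φ φ' →
      pairLp p u φ' = -pairLp p v φ := by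
  simp only [pairLp_apply]
  constructor
  · intro h φ φ' hφ hφ'
    simpa only [hφ'.circleDeriv_eq] using h φ hφ
  · intro h φ hφ
    exact h ⟨φ, hφ.continuous⟩ ⟨_, hφ.continuous_circleDeriv⟩ hφ (hφ.mono le_top).hasDerivAt

lemma HasCircleDeriv.hasWeakDeriv {u v : C(S1, ℂ)} (h : HasCircleDeriv u v) :
    HasWeakDeriv (incl p u) (incl p v) := by
  rw [hasWeakDeriv_iff_pairLp]
  intro φ φ' _ hφ
  have h0 := (meanC_apply _).trans (h.mul hφ).integral_eq_zero
  rw [map_add, meanC_apply, meanC_apply] at h0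
  rw [pairLp_incl, pairLp_incl]
  simp only [ContinuousMap.mul_apply] at h0
  linear_combination h0

lemma isClosed_hasWeakDeriv {X : Type*} [TopologicalSpace X]
    {f g : X → Lp ℂ p (volume : Measure S1)} (hf : Continuous f) (hg : Continuous g) :
    IsClosed {x | HasWeakDeriv (f x) (g x)} := by
  simp only [hasWeakDeriv_iff_pairLp, Set.ofPred_forall]
  refine isClosed_iInter fun φ => isClosed_iInter fun φ' => isClosed_iInter fun _ =>
    isClosed_iInter fun _ => isClosed_eq ?_ ?_
  · exact ((pairLp p).flip φ').continuous.comp hf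
  · exact (((pairLp p).flip φ).continuous.comp hg).neg

lemma hasWeakDeriv_primLp (hp : p ≠ ⊤) (v : Lp ℂ p (volume : Measure S1)) :
    HasWeakDeriv (incl p (primLp p v)) (v - meanLp p v • incl p 1) := by
  refine (ContinuousMap.toLp_denseRange ℂ (volume : Measure S1) ℂ hp).induction_on v
    (isClosed_hasWeakDeriv ((incl p).continuous.comp (primLp p).continuous)
      (continuous_id.sub ((meanLp p).continuous.smul continuous_const))) fun c => ?_
  have h := (hasCircleDeriv_primC c).hasWeakDeriv (p := p)
  rwa [map_sub, map_smul, meanC_apply, ← meanLp_incl (p := p), ← primLp_incl (p := p)] at h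

lemma hasWeakDeriv_const (c : ℂ) : HasWeakDeriv (c • incl p 1) 0 := by
  simpa using (hasCircleDeriv_const c).hasWeakDeriv (p := p)

namespace HasWeakDeriv

variable {u v u' v' : Lp ℂ p (volume : Measure S1)}

lemma sub (h : HasWeakDeriv u v) (h' : HasWeakDeriv u' v') : HasWeakDeriv (u - u') (v - v') := by
  simpa [sub_eq_add_neg] using h.add (h'.smul (-1))

lemma unique (h : HasWeakDeriv u v) (h' : HasWeakDeriv u v') : v = v' := by
  refine (sub_eq_zero.mp (eq_zero_of_forall_smooth fun φ hφ => ?_)).symm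
  obtain ⟨φ', hφ', -⟩ := IsCk.exists_hasCircleDeriv (l := ⊤) hφ
  simpa using (hasWeakDeriv_iff_pairLp.mp (h.sub h') φ φ' hφ hφ').symm

lemma meanLp_eq_zero (h : HasWeakDeriv u v) : meanLp p v = 0 := by
  have h1 := hasWeakDeriv_iff_pairLp.mp h 1 0 (isCk_const ⊤ 1) fun s => hasDerivAt_const s 1
  rwa [map_zero, eq_comm, neg_eq_zero] at h1

lemma eq_const (h : HasWeakDeriv u 0) : u = meanLp p u • incl p 1 := by
  refine sub_eq_zero.mp (eq_zero_of_forall_smooth fun ψ hψ => ?_)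
  have h1 := hasWeakDeriv_iff_pairLp.mp h _ _ (isCk_primC hψ) (hasCircleDeriv_primC ψ)
  have h2 : pairLp p (incl p 1) ψ = meanC ψ := by simp [pairLp_incl, meanC_apply]
  have h3 : pairLp p u 1 = meanLp p u := rfl
  simp only [map_sub, map_smul, map_zero, zero_apply, neg_zero, h3, smul_eq_mul] at h1
  simp only [map_sub, map_smul, sub_apply, smul_apply, h2, smul_eq_mul]
  linear_combination h1

end HasWeakDeriv

lemma hasWeakDeriv_iff (hp : p ≠ ⊤) {u v : Lp ℂ p (volume : Measure S1)} :
    HasWeakDeriv u v ↔ meanLp p v = 0 ∧ ∃ c : ℂ, u = incl p (primLp p v) + c • incl p 1 := by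
  have hP := hasWeakDeriv_primLp hp v
  constructor
  · intro h
    rw [h.meanLp_eq_zero, zero_smul, sub_zero] at hP
    have h1 := h.sub hP
    rw [sub_self] at h1
    exact ⟨h.meanLp_eq_zero, _, (add_eq_of_eq_sub' h1.eq_const.symm).symm⟩
  · rintro ⟨h, c, rfl⟩
    rw [h, zero_smul, sub_zero] at hP
    simpa using hP.add (hasWeakDeriv_const c)

lemma ae_eq_const_iff_eq_smul_incl {u : Lp ℂ p (volume : Measure S1)} {c : ℂ} :
    (∀ᵐ t ∂(volume : Measure S1), u t = c) ↔ u = c • incl p 1 := by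
  have hc : (c • incl p 1 : Lp ℂ p (volume : Measure S1)) =ᵐ[volume] fun _ => c := by
    rw [← map_smul]
    filter_upwards [incl_ae (p := p) (c • 1)] with t ht
    rw [ht]
    simp
  exact ⟨fun h => Lp.ext (EventuallyEq.trans h hc.symm), fun h => h ▸ hc⟩

/-- `L^p`, with the weak derivative. -/
def modelLp (hp : p ≠ ⊤) : CircleModel (Lp ℂ p (volume : Measure S1)) where
  ev u := u
  HasDeriv := HasWeakDeriv
  one := incl p 1
  mean := meanLp p
  prim := (incl p).comp (primLp p)
  ev_ae_eq_const_iff := ae_eq_const_iff_eq_smul_incl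
  mean_eq := meanLp_apply
  hasDeriv_iff := hasWeakDeriv_iff hp
  hasDeriv_prim := hasWeakDeriv_primLp hp
  hasDeriv_unique := HasWeakDeriv.unique

end Weak

/-! ### Lifts of diffeomorphisms -/

section Lift

lemma eq_add_const_of_coe_eq {f g : ℝ → ℝ} (hf : Continuous f) (hg : Continuous g)
    (h : ∀ s, (f s : S1) = g s) : f = fun s => g s + (f 0 - g 0) := by
  refine (AddCircle.isCoveringMap_coe (1 : ℝ)).eq_of_comp_eq hf (by fun_prop) ?_ 0 (by simp)
  funext s
  simp [h]

/-- `ψ` is a continuously differentiable lift to `ℝ` of the map `h` of the circle. -/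
structure IsLift (h : S1 → S1) (ψ : ℝ → ℝ) : Prop where
  contDiff : ContDiff ℝ 1 ψ
  coe : ∀ s : ℝ, h (s : S1) = (ψ s : S1)

namespace IsLift

variable {h : S1 → S1} {ψ : ℝ → ℝ}

lemma hasDerivAt (hψ : IsLift h ψ) (s : ℝ) : HasDerivAt ψ (deriv ψ s) s :=
  (hψ.contDiff.differentiable one_ne_zero s).hasDerivAt

lemma deriv_periodic (hψ : IsLift h ψ) : Function.Periodic (deriv ψ) 1 := by
  have hc := hψ.contDiff.continuous
  have hshift : (fun s => ψ (s + 1)) = fun s => ψ s + (ψ (0 + 1) - ψ 0) :=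
    eq_add_const_of_coe_eq (by fun_prop) hc fun s => by
      rw [← hψ.coe, ← hψ.coe, AddCircle.coe_add_period]
  intro s
  rw [← deriv_comp_add_const, hshift, deriv_add_const]

lemma exists_lipschitzWith (hψ : IsLift h ψ) : ∃ K, LipschitzWith K ψ := by
  have hc : Continuous (deriv ψ) := hψ.contDiff.continuous_deriv le_rfl
  obtain ⟨K, hK⟩ := (hψ.deriv_periodic.isBounded_of_continuous one_ne_zero hc).exists_norm_le
  have hK0 : 0 ≤ K := (norm_nonneg _).trans (hK _ ⟨0, rfl⟩)
  exact ⟨⟨K, hK0⟩, lipschitzWith_of_nnnorm_deriv_le (fun s => (hψ.hasDerivAt s).differentiableAt)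
    fun s => hK _ ⟨s, rfl⟩⟩

end IsLift

lemma volume_coe_preimage_inter_Ioc_le {s : Set S1} (hs : MeasurableSet s) (a : ℝ) (n : ℕ) :
    volume (((↑) : ℝ → S1) ⁻¹' s ∩ Set.Ioc a (a + n)) ≤ n * volume s := by
  induction n with
  | zero => simp
  | succ n ih =>
    have hsub : ((↑) : ℝ → S1) ⁻¹' s ∩ Set.Ioc a (a + (n + 1 : ℕ)) ⊆
        (((↑) : ℝ → S1) ⁻¹' s ∩ Set.Ioc a (a + n)) ∪
          (((↑) : ℝ → S1) ⁻¹' s ∩ Set.Ioc (a + n) (a + n + 1)) := by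
      rw [← Set.inter_union_distrib_left, Nat.cast_succ, ← add_assoc]
      exact Set.inter_subset_inter_right _ Set.Ioc_subset_Ioc_union_Ioc
    calc _ ≤ n * volume s + volume s :=
          (measure_mono hsub).trans ((measure_union_le _ _).trans (add_le_add ih
            (AddCircle.add_projection_respects_measure 1 (a + n) hs).ge))
      _ = (n + 1 : ℕ) * volume s := by push_cast; ring

/- Up to translation `χ ∘ ψ = id`. So `h ⁻¹' s` is the image of the part of `s` met by
`ψ '' (0, 1]`, which is bounded, under the Lipschitz map `χ`. -/
lemma exists_map_volume_le (h : S1 ≃ₜ S1) {ψ χ : ℝ → ℝ} (hψ : IsLift h ψ)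
    (hχ : IsLift h.symm χ) :
    ∃ C : ℝ≥0∞, C ≠ ⊤ ∧ (volume : Measure S1).map h ≤ C • (volume : Measure S1) := by
  have hψc := hψ.contDiff.continuous
  have hinv : id = fun s => χ (ψ s) + (0 - χ (ψ 0)) :=
    eq_add_const_of_coe_eq continuous_id (hχ.contDiff.continuous.comp hψc) fun s => by
      rw [id, ← hχ.coe, ← hψ.coe, h.symm_apply_apply]
  obtain ⟨R, hR⟩ := isCompact_Icc.exists_bound_of_continuousOn (s := Set.Icc (0 : ℝ) (0 + 1))
    hψc.continuousOn
  obtain ⟨N, hN⟩ := exists_nat_gt R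
  obtain ⟨K, hK⟩ := hχ.exists_lipschitzWith
  have hK' : LipschitzWith K fun s => χ s + (0 - χ (ψ 0)) := fun x y => by simpa using hK x y
  refine ⟨K * (2 * N : ℕ), ENNReal.mul_ne_top ENNReal.coe_ne_top (ENNReal.natCast_ne_top _),
    Measure.le_iff.mpr fun s hs => ?_⟩
  have hsub : ((↑) : ℝ → S1) ⁻¹' (h ⁻¹' s) ∩ Set.Ioc (0 : ℝ) (0 + 1) ⊆
      (fun s => χ s + (0 - χ (ψ 0))) ''
        (((↑) : ℝ → S1) ⁻¹' s ∩ Set.Ioc (-N : ℝ) (-N + (2 * N : ℕ))) := by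
    rintro x ⟨hxs, hx⟩
    have hxN := abs_lt.mp ((hR x (Set.Ioc_subset_Icc_self hx)).trans_lt hN)
    refine ⟨ψ x, ⟨?_, hxN.1, by push_cast; linarith [hxN.2]⟩, (congrFun hinv x).symm⟩
    rwa [Set.mem_preimage, ← hψ.coe]
  calc (volume : Measure S1).map h s
      = volume (((↑) : ℝ → S1) ⁻¹' (h ⁻¹' s) ∩ Set.Ioc (0 : ℝ) (0 + 1)) := by
        rw [Measure.map_apply h.continuous.measurable hs]
        exact AddCircle.add_projection_respects_measure 1 0 (h.continuous.measurable hs)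
    _ ≤ K * volume (((↑) : ℝ → S1) ⁻¹' s ∩ Set.Ioc (-N : ℝ) (-N + (2 * N : ℕ))) := by
        refine (measure_mono hsub).trans ?_
        simpa [hausdorffMeasure_real] using hK'.hausdorffMeasure_image_le zero_le_one _
    _ ≤ K * ((2 * N : ℕ) * volume s) := by
        gcongr
        exact volume_coe_preimage_inter_Ioc_le hs _ _
    _ = _ := by rw [Measure.smul_apply, smul_eq_mul, mul_assoc]

end Lift

namespace CircleDiffeo

variable {k : ℕ∞} (φ : CircleDiffeo k)

lemma isLift_choose (hk : 1 ≤ k) : IsLift φ.toHomeomorph φ.exists_lift.choose :=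
  ⟨φ.exists_lift.choose_spec.1.of_le (by exact_mod_cast hk), φ.exists_lift.choose_spec.2⟩

lemma deriv_coe (hk : 1 ≤ k) (s : ℝ) :
    φ.deriv (s : S1) = _root_.deriv φ.exists_lift.choose s := by
  have hper := (φ.isLift_choose hk).deriv_periodic
  exact (hper.lift_coe _).symm.trans (by rw [AddCircle.coe_equivIco, hper.lift_coe])

lemma isCk_deriv {l : ℕ∞} (hk : l + 1 ≤ k) : IsCk l (fun t => (φ.deriv t : ℂ)) := by
  have hlift : ContDiff ℝ ((l : WithTop ℕ∞) + 1) φ.exists_lift.choose :=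
    φ.exists_lift.choose_spec.1.of_le (by exact_mod_cast hk)
  unfold IsCk
  simp only [φ.deriv_coe (le_add_self.trans hk)]
  exact Complex.ofRealCLM.contDiff.comp (contDiff_succ_iff_deriv.mp hlift).2.2

end CircleDiffeo

/-! ### Pullback operators -/

/-- The operator `u ↦ c · (u ∘ h)` on the continuous functions. -/
def pullC (h : C(S1, S1)) (c : C(S1, ℂ)) : C(S1, ℂ) →L[ℂ] C(S1, ℂ) :=
  (ContinuousLinearMap.mul ℂ C(S1, ℂ) c).comp (h.compCLM ℂ ℂ)

lemma pullC_apply (h : C(S1, S1)) (c u : C(S1, ℂ)) (t : S1) : pullC h c u t = c t * u (h t) := rfl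

lemma HasCircleDeriv.mul_comp {h : C(S1, S1)} {ψ : ℝ → ℝ} (hψ : IsLift h ψ) {θ c c' u v : C(S1, ℂ)}
    (hθ : ∀ s : ℝ, θ (s : S1) = deriv ψ s) (hc : HasCircleDeriv c c') (hu : HasCircleDeriv u v) :
    HasCircleDeriv (pullC h c u) (pullC h c' u + pullC h (c * θ) v) := by
  intro s
  have hcomp : HasDerivAt (fun s : ℝ => u (h s)) (deriv ψ s • v (h s)) s := by
    simp only [hψ.coe]
    exact (hu (ψ s)).scomp s (hψ.hasDerivAt s)
  refine ((hc s).mul hcomp).congr_deriv ?_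
  rw [ContinuousMap.add_apply, pullC_apply, pullC_apply, ContinuousMap.mul_apply, hθ,
    Complex.real_smul, mul_assoc]

/-- The pullback operators on the continuous functions. -/
def pullbackC {h : C(S1, S1)} {ψ : ℝ → ℝ} (hψ : IsLift h ψ) {θ : C(S1, ℂ)}
    (hθ : ∀ s : ℝ, θ (s : S1) = deriv ψ s) : modelC.Pullback h θ where
  op := pullC h
  ev_op _ _ := ae_of_all _ fun _ => rfl
  hasDeriv_op hc hu := hc.mul_comp hψ hθ hu

section PullLp

variable {p : ℝ≥0∞} [Fact (1 ≤ p)] {h : C(S1, S1)} {C : ℝ≥0∞}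

lemma ae_comp_of_map_le (hle : (volume : Measure S1).map h ≤ C • volume) {q : S1 → Prop}
    (hq : ∀ᵐ t ∂(volume : Measure S1), q t) : ∀ᵐ t ∂(volume : Measure S1), q (h t) :=
  ae_of_ae_map h.continuous.aemeasurable
    ((Measure.absolutelyContinuous_of_le_smul hle).ae_le hq)

/-- The operator `u ↦ u ∘ h` on `L^p`, where `h` maps the measure of the circle to at most a
multiple of itself, as a real linear map. -/
def realCompLp (hC : C ≠ ⊤) (hle : (volume : Measure S1).map h ≤ C • volume) :
    Lp ℂ p (volume : Measure S1) →L[ℝ] Lp ℂ p (volume : Measure S1) :=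
  (Lp.compMeasurePreservingₗᵢ ℝ h
    (h.continuous.measurable.measurePreserving volume)).toContinuousLinearMap.comp
    (Lp.LpToLpOfMeasureLeSMul hC hle)

lemma realCompLp_ae (hC : C ≠ ⊤) (hle : (volume : Measure S1).map h ≤ C • volume)
    (u : Lp ℂ p (volume : Measure S1)) : realCompLp hC hle u =ᵐ[volume] u ∘ h :=
  (Lp.coeFn_compMeasurePreserving _ _).trans (ae_eq_comp h.continuous.aemeasurable
    (Lp.coeFn_LpToLpOfMeasureLeSMul hC hle u))

/-- `realCompLp`, as a complex linear operator. -/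
def compLp (hC : C ≠ ⊤) (hle : (volume : Measure S1).map h ≤ C • volume) :
    Lp ℂ p (volume : Measure S1) →L[ℂ] Lp ℂ p (volume : Measure S1) :=
  { realCompLp hC hle with
    map_smul' := fun a u => by
      refine Lp.ext ?_
      filter_upwards [realCompLp_ae hC hle (a • u), realCompLp_ae hC hle u,
        Lp.coeFn_smul a (realCompLp hC hle u), ae_comp_of_map_le hle (Lp.coeFn_smul a u)]
        with t hcomp_smul hcomp hsmul_comp hsmul
      exact hcomp_smul.trans (hsmul.trans (((congrArg (a • ·) hcomp).symm).trans hsmul_comp.symm)) }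

lemma compLp_ae (hC : C ≠ ⊤) (hle : (volume : Measure S1).map h ≤ C • volume)
    (u : Lp ℂ p (volume : Measure S1)) : compLp hC hle u =ᵐ[volume] u ∘ h :=
  realCompLp_ae hC hle u

/-- The operator `u ↦ c · (u ∘ h)` on `L^p`. -/
def pullLp (hC : C ≠ ⊤) (hle : (volume : Measure S1).map h ≤ C • volume) (c : C(S1, ℂ)) :
    Lp ℂ p (volume : Measure S1) →L[ℂ] Lp ℂ p (volume : Measure S1) :=
  ((ContinuousLinearMap.mul ℂ ℂ).holderL volume ⊤ p p (incl ⊤ c)).comp (compLp hC hle)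

lemma pullLp_ae (hC : C ≠ ⊤) (hle : (volume : Measure S1).map h ≤ C • volume) (c : C(S1, ℂ))
    (u : Lp ℂ p (volume : Measure S1)) :
    ∀ᵐ t ∂(volume : Measure S1), pullLp hC hle c u t = c t * u (h t) := by
  filter_upwards [(ContinuousLinearMap.mul ℂ ℂ).coeFn_holder (r := p) (incl ⊤ c)
    (compLp hC hle u), compLp_ae hC hle u, incl_ae (p := ⊤) c] with t hmul hcomp hc
  refine hmul.trans ?_
  rw [ContinuousLinearMap.mul_apply', hcomp, hc, Function.comp_apply]

lemma pullLp_incl (hC : C ≠ ⊤) (hle : (volume : Measure S1).map h ≤ C • volume)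
    (c u : C(S1, ℂ)) : pullLp hC hle c (incl p u) = incl p (pullC h c u) := by
  refine Lp.ext ?_
  filter_upwards [pullLp_ae hC hle c (incl p u), incl_ae (p := p) (pullC h c u),
    ae_comp_of_map_le hle (incl_ae (p := p) u)] with t hpull hincl hu
  rw [hpull, hincl, hu, pullC_apply]

lemma HasWeakDeriv.mul_comp (hp : p ≠ ⊤) (hC : C ≠ ⊤)
    (hle : (volume : Measure S1).map h ≤ C • volume) {ψ : ℝ → ℝ} (hψ : IsLift h ψ)
    {θ c c' : C(S1, ℂ)} (hθ : ∀ s : ℝ, θ (s : S1) = deriv ψ s) (hc : HasCircleDeriv c c')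
    {u v : Lp ℂ p (volume : Measure S1)} (hu : HasWeakDeriv u v) :
    HasWeakDeriv (pullLp hC hle c u) (pullLp hC hle c' u + pullLp hC hle (c * θ) v) := by
  obtain ⟨hv, κ, rfl⟩ := (hasWeakDeriv_iff hp).mp hu
  let prim (w : Lp ℂ p (volume : Measure S1)) := incl p (primLp p w) + κ • incl p 1
  have hprim : Continuous prim :=
    ((incl p).continuous.comp (primLp p).continuous).add continuous_const
  suffices hdense : ∀ w, HasWeakDeriv (pullLp hC hle c (prim w)) (pullLp hC hle c' (prim w) +
      pullLp hC hle (c * θ) (w - meanLp p w • incl p 1)) by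
    simpa only [hv, zero_smul, sub_zero] using hdense v
  intro w
  refine (ContinuousMap.toLp_denseRange ℂ (volume : Measure S1) ℂ hp).induction_on w
    (isClosed_hasWeakDeriv ((pullLp hC hle c).continuous.comp hprim)
      (((pullLp hC hle c').continuous.comp hprim).add ((pullLp hC hle (c * θ)).continuous.comp
        (continuous_id.sub ((meanLp p).continuous.smul continuous_const))))) fun g => ?_
  have hg := hc.mul_comp hψ hθ ((hasCircleDeriv_primC g).add (hasCircleDeriv_const κ))
  simpa only [prim, map_add, map_sub, map_smul, add_zero, ← pullLp_incl hC hle, meanC_apply,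
    ← meanLp_incl (p := p), ← primLp_incl (p := p)] using hg.hasWeakDeriv (p := p)

/-- The pullback operators on `L^p`. -/
def pullbackLp (hp : p ≠ ⊤) (hC : C ≠ ⊤) (hle : (volume : Measure S1).map h ≤ C • volume)
    {ψ : ℝ → ℝ} (hψ : IsLift h ψ) {θ : C(S1, ℂ)} (hθ : ∀ s : ℝ, θ (s : S1) = deriv ψ s) :
    (modelLp (p := p) hp).Pullback h θ where
  op := pullLp hC hle
  ev_op := pullLp_ae hC hle
  hasDeriv_op hc hu := HasWeakDeriv.mul_comp hp hC hle hψ hθ hc hu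

end PullLp

namespace CircleDiffeo

variable {l k : ℕ∞} (φ : CircleDiffeo k)

lemma exists_pullbackC (hk : l + 1 ≤ k) :
    ∃ θ : C(S1, ℂ), (∀ t, θ t = φ.deriv t) ∧ IsCk l θ ∧
      Nonempty (modelC.Pullback φ.toHomeomorph θ) := by
  have hk1 : 1 ≤ k := le_add_self.trans hk
  have hθ := φ.isCk_deriv hk
  exact ⟨⟨_, hθ.continuous⟩, fun _ => rfl, hθ,
    ⟨pullbackC (h := φ.toHomeomorph) (φ.isLift_choose hk1)
      fun s => congrArg Complex.ofReal (φ.deriv_coe hk1 s)⟩⟩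

lemma exists_pullbackLp {p : ℝ≥0∞} [Fact (1 ≤ p)] (hp : p ≠ ⊤) (hk : l + 1 ≤ k) :
    ∃ θ : C(S1, ℂ), (∀ t, θ t = φ.deriv t) ∧ IsCk l θ ∧
      Nonempty ((modelLp (p := p) hp).Pullback φ.toHomeomorph θ) := by
  have hk1 : 1 ≤ k := le_add_self.trans hk
  have hθ := φ.isCk_deriv hk
  obtain ⟨χ, hχ, hχ'⟩ := φ.exists_lift_symm
  obtain ⟨C, hC, hle⟩ := exists_map_volume_le φ.toHomeomorph (φ.isLift_choose hk1)
    ⟨hχ.of_le (by exact_mod_cast hk1), hχ'⟩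
  exact ⟨⟨_, hθ.continuous⟩, fun _ => rfl, hθ,
    ⟨pullbackLp (h := φ.toHomeomorph) hp hC hle (φ.isLift_choose hk1)
      fun s => congrArg Complex.ofReal (φ.deriv_coe hk1 s)⟩⟩

end CircleDiffeo

/-! ### The spaces `C^l` and `W^{l,p}` -/

namespace CircleModel

variable {E : Type*} [NormedAddCommGroup E] [NormedSpace ℂ E] {M : CircleModel E}
  {X : Type} [TopologicalSpace X]

lemma hasDerivsUpTo_iff_of_chain {n : ℕ} {w : ∀ j ≤ n, X → E}
    (hw : ∀ (j : ℕ) (hj : j + 1 ≤ n) (x : X),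
      M.HasDeriv (w j (j.le_succ.trans hj) x) (w (j + 1) hj x)) :
    M.HasDerivsUpTo n (w 0 n.zero_le) ↔ ∀ (j : ℕ) (hj : j ≤ n), Continuous (w j hj) := by
  induction n with
  | zero =>
    refine ⟨fun h j hj => ?_, fun h => h 0 le_rfl⟩
    obtain rfl := Nat.le_zero.mp hj
    exact h
  | succ n ih =>
    have ih' := ih (w := fun j hj => w (j + 1) (Nat.succ_le_succ hj))
      fun j hj => hw (j + 1) (Nat.succ_le_succ hj)
    refine ⟨fun h j hj => ?_, fun h => ⟨h 0 _, _, hw 0 (Nat.le_add_left 1 n),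
      ih'.mpr fun j hj => h (j + 1) _⟩⟩
    cases j with
    | zero => exact h.continuous
    | succ j => exact ih'.mp (h.deriv (hw 0 (Nat.le_add_left 1 n))) j (Nat.le_of_succ_le_succ hj)

lemma hasDerivs_iff_of_chain {l : ℕ∞} {w : ∀ j : ℕ, (j : ℕ∞) ≤ l → X → E}
    (hw : ∀ (j : ℕ) (hj : (j : ℕ∞) ≤ l) (hj' : ((j + 1 : ℕ) : ℕ∞) ≤ l) (x : X),
      M.HasDeriv (w j hj x) (w (j + 1) hj' x)) :
    M.HasDerivs l (w 0 (by simp)) ↔ ∀ (j : ℕ) (hj : (j : ℕ∞) ≤ l), Continuous (w j hj) := by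
  have hn (n : ℕ) (hn : (n : ℕ∞) ≤ l) := M.hasDerivsUpTo_iff_of_chain
    (w := fun j hj => w j ((Nat.cast_le.mpr hj).trans hn)) fun j _ => hw j _ _
  exact ⟨fun h j hj => (hn j hj).mp (h j hj) j le_rfl,
    fun h n hnl => (hn n hnl).mpr fun j _ => h j _⟩

lemma HasDerivsUpTo.exists_chain {n : ℕ} {u : X → E} (h : M.HasDerivsUpTo n u) :
    ∃ w : ℕ → X → E, w 0 = u ∧ ∀ j < n, ∀ x, M.HasDeriv (w j x) (w (j + 1) x) := by
  induction n generalizing u with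
  | zero => exact ⟨fun _ => u, rfl, fun j hj => absurd hj j.not_lt_zero⟩
  | succ n ih =>
    obtain ⟨-, v, huv, hv⟩ := h
    obtain ⟨w, rfl, hw⟩ := ih hv
    refine ⟨fun j => Nat.casesOn j u w, rfl, fun j hj => ?_⟩
    cases j with
    | zero => exact huv
    | succ j => exact hw j (Nat.lt_of_succ_lt_succ hj)

end CircleModel

lemma isCk_of_hasDerivsUpTo {X : Type} [TopologicalSpace X] {n : ℕ} {u : X → C(S1, ℂ)}
    (hu : modelC.HasDerivsUpTo n u) (x : X) : IsCk n (u x) := by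
  induction n generalizing u with
  | zero => exact contDiff_zero.mpr (continuous_coe (u x))
  | succ n ih =>
    obtain ⟨-, v, huv, hv⟩ := hu
    exact HasCircleDeriv.isCk_succ (huv x) (ih hv)

namespace Ck

variable {l : ℕ∞}

/-- The inclusion of `C^l` into the continuous functions. -/
def toC : Ck l →ₗ[ℂ] C(S1, ℂ) where
  toFun x := x.iterDeriv 0 (by simp)
  map_add' _ _ := rfl
  map_smul' _ _ := rfl

lemma hasCircleDeriv_iterDeriv (x : Ck l) {j : ℕ} (hj : (j : ℕ∞) ≤ l)
    (hj' : ((j + 1 : ℕ) : ℕ∞) ≤ l) :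
    HasCircleDeriv (x.iterDeriv j hj) (x.iterDeriv (j + 1) hj') := by
  intro s
  have hx : ContDiff ℝ (l : WithTop ℕ∞) (fun s : ℝ => x.fn (s : S1)) := x.2
  have hjl : (j : ℕ∞) < l := (Nat.cast_lt.mpr j.lt_succ_self).trans_le hj'
  have h := (hx.differentiable_iteratedDeriv j (by exact_mod_cast hjl) s).hasDerivAt
  rwa [← iteratedDeriv_succ, ← circleDeriv_iterate_coe, ← circleDeriv_iterate_coe] at h

lemma hasCircleDeriv_dot (y : Ck (l + 1)) : HasCircleDeriv y.toC y.dot.toC :=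
  y.hasCircleDeriv_iterDeriv (j := 0) (by simp) (by simp)

lemma realizes (l : ℕ∞) : modelC.Realizes l (fn (l := l)) toC where
  injective _ _ h := Subtype.ext (congrArg DFunLike.coe h)
  eq_ev _ := rfl
  exists_of_hasDerivs u hu :=
    ⟨⟨u, contDiff_iff_forall_nat_le.mpr fun n hn => isCk_of_hasDerivsUpTo (hu n hn) ()⟩, rfl⟩
  continuous_iff T := by
    rw [continuous_induced_rng, continuous_pi_iff, Subtype.forall]
    exact (CircleModel.hasDerivs_iff_of_chain (w := fun j hj x => (T x).iterDeriv j hj)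
      fun j hj hj' x => (T x).hasCircleDeriv_iterDeriv hj hj').symm

end Ck

namespace Sob

variable {l : ℕ} {p : ℝ≥0∞} [Fact (1 ≤ p)]

/-- The inclusion of `W^{l,p}` into `L^p`. -/
def toLp : Sob l p →ₗ[ℂ] Lp ℂ p (volume : Measure S1) := (sobolevSubmodule l p).subtype

lemma hasWeakDeriv_dot (y : Sob (l + 1) p) : HasWeakDeriv y.toLp y.dot.toLp := by
  have h := y.weakDeriv_spec.2 0 l.succ_pos
  rwa [y.weakDeriv_spec.1] at h

lemma realizes (hp : p ≠ ⊤) : (modelLp (p := p) hp).Realizes l (fn (l := l) (p := p)) toLp where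
  injective := Subtype.val_injective
  eq_ev _ := rfl
  exists_of_hasDerivs u hu := by
    obtain ⟨w, hw0, hw⟩ := (hu l le_rfl).exists_chain
    exact ⟨⟨u, fun j => w j (), congrFun hw0 (), fun j hj => hw j hj ()⟩, rfl⟩
  continuous_iff T := by
    have hw0 : (fun x => (T x).toLp) = fun x => (T x).weakDeriv 0 :=
      funext fun x => (T x).weakDeriv_spec.1.symm
    rw [continuous_induced_rng, continuous_pi_iff, hw0,
      CircleModel.hasDerivs_iff_of_chain (w := fun j _ x => (T x).weakDeriv j)
        fun j _ hj x => (T x).weakDeriv_spec.2 j (by exact_mod_cast hj)]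
    exact ⟨fun h j hj => h ⟨j, Nat.lt_succ_of_le (by exact_mod_cast hj)⟩,
      fun h j => h j (by exact_mod_cast j.is_le)⟩

end Sob

end LoopSpace

end

open LoopSpace in
theorem theorem2p1 :
    -- loops of class `C^k`, `k = l + 1 = 1, 2, …, ∞`
    (∀ l : ℕ∞,
      (∀ F ∈ FSpace (Ck.fn (l := l + 1)), F ∈ FHom (Ck.fn (l := l + 1)) 0 ↔ IsGFixed F) ∧
      Module.finrank ℂ (integralLine (Ck.fn (l := l))) = 1 ∧
      ∃ e : ((Ck l →L_c[ℂ] ℂ) ⧸ integralLine (Ck.fn (l := l)))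
          ≃L[ℂ] FHom (Ck.fn (l := l + 1)) 0,
        (∀ (Φ : Ck l →L_c[ℂ] ℂ) (ζ : ℂ) (y : Ck (l + 1)),
          (e (Submodule.Quotient.mk Φ)).1 (ζ, y) = Φ y.dot) ∧
        ∀ φ : CircleDiffeo (l + 1),
          ∃ (A : Ck (l + 1) →L[ℂ] Ck (l + 1)) (B : Ck l →L[ℂ] Ck l),
            IsFunctionPullback φ Ck.fn A ∧ IsFormPullback φ Ck.fn B ∧
            ∀ Φ Ψ : Ck l →L_c[ℂ] ℂ, (∀ x, Ψ x = Φ (B x)) → ∀ (ζ : ℂ) (y : Ck (l + 1)),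
              (e (Submodule.Quotient.mk Ψ)).1 (ζ, y) = (e (Submodule.Quotient.mk Φ)).1 (ζ, A y)) ∧
    -- loops of class `W^{k,p}`, `k = l + 1 = 1, 2, …`, `1 ≤ p < ∞`
    (∀ (l : ℕ) (p : ℝ≥0∞) [Fact (1 ≤ p)], p ≠ ⊤ →
      (∀ F ∈ FSpace (Sob.fn (l := l + 1) (p := p)),
        F ∈ FHom (Sob.fn (l := l + 1) (p := p)) 0 ↔ IsGFixed F) ∧
      Module.finrank ℂ (integralLine (Sob.fn (l := l) (p := p))) = 1 ∧
      ∃ e : ((Sob l p →L_c[ℂ] ℂ) ⧸ integralLine (Sob.fn (l := l) (p := p)))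
          ≃L[ℂ] FHom (Sob.fn (l := l + 1) (p := p)) 0,
        (∀ (Φ : Sob l p →L_c[ℂ] ℂ) (ζ : ℂ) (y : Sob (l + 1) p),
          (e (Submodule.Quotient.mk Φ)).1 (ζ, y) = Φ y.dot) ∧
        ∀ φ : CircleDiffeo ((l + 1 : ℕ) : ℕ∞),
          ∃ (A : Sob (l + 1) p →L[ℂ] Sob (l + 1) p) (B : Sob l p →L[ℂ] Sob l p),
            IsFunctionPullback φ Sob.fn A ∧ IsFormPullback φ Sob.fn B ∧
            ∀ Φ Ψ : Sob l p →L_c[ℂ] ℂ, (∀ x, Ψ x = Φ (B x)) → ∀ (ζ : ℂ) (y : Sob (l + 1) p),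
              (e (Submodule.Quotient.mk Ψ)).1 (ζ, y) =
                (e (Submodule.Quotient.mk Φ)).1 (ζ, A y)) := by
  refine ⟨fun l => ?_, fun l p _ hp => ?_⟩
  · exact (Ck.realizes (l + 1)).exists_equivariant_equiv (Ck.realizes l) Ck.hasCircleDeriv_dot
      fun φ => φ.exists_pullbackC le_rfl
  · have hV := Sob.realizes (l := l + 1) hp
    rw [Nat.cast_succ] at hV
    exact hV.exists_equivariant_equiv (Sob.realizes hp) Sob.hasWeakDeriv_dot
      fun φ => φ.exists_pullbackLp hp (Nat.cast_succ l).ge
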